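/- Setting. For $n \in \mathbb{N}$ let $\mathcal{S}_n$ be the group of permutations of $[n]=\{1,\dots,n\}$, acting on $\mathbb{R}^n$ by $\gamma(x) = (x_{\gamma^{-1}(1)},\dots,x_{\gamma^{-1}(n)})$. A group $\Gamma \le \mathcal{S}_n$ is a symmetry group of a binary program $\max\{c\cdot x : Ax \le b,\ x \in \{0,1\}^n\}$ if every $\gamma \in \Gamma$ maps feasible solutions to feasible solutions and preserves their objective values. Let $L=(\ell_1,\dots,\ell_n)$ be an ordering of $[n]$ (the leaders). For each $k$ let $O_{\ell_k}$ be the orbit of $\ell_k$ under the subgroup of all $\gamma\in\Gamma$ that fix each of $\ell_1,\dots,\ell_{k-1}$. The set of all Schreier-Sims table (SST) cuts is $S(L) = \{(\ell,f) : \ell \in L,\ f \in O_\ell\setminus\{\ell\}\}$, and $\mathcal{K}(S) = \{x \in \mathbb{R}^n : -x_\ell + x_f \le 0 \text{ for all } (\ell,f)\in S\}$. To solve a program means to find an optimal solution, or to report that the program is infeasible. Running times are numbers of steps of a random access machine on natural numbers with unit costs whose arithmetic operations are addition and truncated subtraction. Theorem. There is a polynomial $p$ such that the following holds. Let $(P_i)_{i\in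 I}$ be any class of binary programs $P_i = \max\{c\cdot x : Ax\le b,\ x\in\{0,1\}^{n}\}$ (where $A,b,c,n$ depend on $i$), given under any encoding of $i \in I$ by finite sequences of natural numbers, and let $M$ be an algorithm that solves each $P_i$ in at most $T_i$ steps. Then there is an algorithm $M'$ that, given the encoding of any $i \in I$, any $m$ permutations of $[n]$ generating a symmetry group $\Gamma \le \mathcal{S}_n$ of $P_i$, and any ordering $L$ of $[n]$, solves $$\max\{c\cdot x : Ax \le b,\ x \in \{0,1\}^n,\ x \in \mathcal{K}(S(L))\}$$ in at most $T_i + p(n+m)$ steps; in particular in $T_i + \mathrm{poly}(n)$ steps if $\Gamma$ is given by $\mathrm{poly}(n)$ generators. Moreover, if $M$ returns a solution $\hat{x}$ of $P_i$ after $t$ steps, then $M'$ returns, after at most $t + p(n+m)$ steps, a vector $\gamma(\hat{x})$ with $\gamma\in\Gamma$ that satisfies all SST cuts. -/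

import Mathlib

namespace SST

/-! ### Binary programs, symmetries and Schreier-Sims table (SST) cuts

Variables are indexed by `Fin n`, that is by `0, …, n - 1`. -/

/-- The data of `max {c·x : A x ≤ b, x ∈ {0,1}^n}`. -/
structure BinaryProgram (n : ℕ) where
  /-- number of constraints -/
  rows : ℕ
  A : Matrix (Fin rows) (Fin n) ℝ
  b : Fin rows → ℝ
  c : Fin n → ℝ

/-- The feasible region `{x ∈ {0,1}^n : A x ≤ b}`. -/
def BinaryProgram.feasible {n : ℕ} (P : BinaryProgram n) : Set (Fin n → ℝ) :=
  {x | (∀ i, x i = 0 ∨ x i = 1) ∧ P.A.mulVec x ≤ P.b}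

/-- `x` is an optimal solution of `max {c·x : x ∈ X}`. -/
def IsOptimal {n : ℕ} (X : Set (Fin n → ℝ)) (c : Fin n → ℝ) (x : Fin n → ℝ) : Prop :=
  x ∈ X ∧ ∀ y ∈ X, c ⬝ᵥ y ≤ c ⬝ᵥ x

/-- A permutation acts on vectors by `γ(x) = (x_{γ⁻¹(1)}, …, x_{γ⁻¹(n)})`. -/
def permAct {n : ℕ} (γ : Equiv.Perm (Fin n)) (x : Fin n → ℝ) : Fin n → ℝ :=
  fun i => x (γ⁻¹ i)

/-- `Γ` is a symmetry group of `P`: every element of `Γ` maps feasible solutions to feasible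
solutions and preserves their objective values. -/
def IsSymmetryGroup {n : ℕ} (P : BinaryProgram n) (Γ : Subgroup (Equiv.Perm (Fin n))) : Prop :=
  ∀ γ ∈ Γ, ∀ x ∈ P.feasible, permAct γ x ∈ P.feasible ∧ P.c ⬝ᵥ permAct γ x = P.c ⬝ᵥ x

/-- The pointwise stabilizer of `I` in `Γ`. -/
def stab {n : ℕ} (Γ : Subgroup (Equiv.Perm (Fin n))) (I : Set (Fin n)) :
    Subgroup (Equiv.Perm (Fin n)) :=
  Γ ⊓ fixingSubgroup (Equiv.Perm (Fin n)) I

/-- The orbit `O_ℓ` of the `k`-th leader `ℓ = L k`, taken in the pointwise stabilizer of the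
leaders chosen before it. -/
def leaderOrbit {n : ℕ} (Γ : Subgroup (Equiv.Perm (Fin n))) (L : Fin n → Fin n) (k : Fin n) :
    Set (Fin n) :=
  MulAction.orbit (stab Γ {i | ∃ j < k, i = L j}) (L k)

/-- The set `S(L)` of all SST cuts, as pairs (leader, follower). -/
def sstCuts {n : ℕ} (Γ : Subgroup (Equiv.Perm (Fin n))) (L : Fin n → Fin n) :
    Set (Fin n × Fin n) :=
  {q | ∃ k, q.1 = L k ∧ q.2 ∈ leaderOrbit Γ L k ∧ q.2 ≠ L k}

/-- The cone `K(S)` defined by a set of SST cuts. -/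
def cutCone {n : ℕ} (S : Set (Fin n × Fin n)) : Set (Fin n → ℝ) :=
  {x | ∀ q ∈ S, -x q.1 + x q.2 ≤ 0}

/-! ### The machine model

A random access machine with unit costs, programmed in a structured language. The memory has
registers holding natural numbers and arrays of natural numbers with random access; a program
mentions only finitely many registers and arrays. The arithmetic is addition and truncated
subtraction only, so that numbers gain at most one bit per step. -/

/-- Memory contents. -/
structure State where
  reg : ℕ → ℕ
  arr : ℕ → ℕ → ℕ

/-- Assign `v` to register `x`. -/
def State.setReg (s : State) (x v : ℕ) : State :=
  { s with reg := Function.update s.reg x v }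

/-- Assign `v` to cell `i` of array `a`. -/
def State.setArr (s : State) (a i v : ℕ) : State :=
  { s with arr := Function.update s.arr a (Function.update (s.arr a) i v) }

/-- Programs; the arguments of type `ℕ` are names of registers and arrays, except for the
literal in `const`. -/
inductive Prog where
  /-- `x := v` for a literal `v` -/
  | const (x v : ℕ)
  /-- `x := y` -/
  | copy (x y : ℕ)
  /-- `x := y + z` -/
  | add (x y z : ℕ)
  /-- `x := max (y - z) 0` -/
  | sub (x y z : ℕ)
  /-- `x := a[y]` -/
  | load (x a y : ℕ)
  /-- `a[x] := y` -/
  | store (a x y : ℕ)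
  /-- first `p`, then `q` -/
  | seq (p q : Prog)
  /-- if `x ≠ 0` then `p` else `q` -/
  | cond (x : ℕ) (p q : Prog)
  /-- while `x ≠ 0` do `p` -/
  | loop (x : ℕ) (p : Prog)

/-- `Exec p s t s'`: started in memory `s`, the program `p` halts after exactly `t` steps with
memory `s'`. Every assignment and every test is one step. -/
inductive Exec : Prog → State → ℕ → State → Prop where
  | const (x v : ℕ) (s : State) : Exec (.const x v) s 1 (s.setReg x v)
  | copy (x y : ℕ) (s : State) : Exec (.copy x y) s 1 (s.setReg x (s.reg y))
  | add (x y z : ℕ) (s : State) : Exec (.add x y z) s 1 (s.setReg x (s.reg y + s.reg z))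
  | sub (x y z : ℕ) (s : State) : Exec (.sub x y z) s 1 (s.setReg x (s.reg y - s.reg z))
  | load (x a y : ℕ) (s : State) : Exec (.load x a y) s 1 (s.setReg x (s.arr a (s.reg y)))
  | store (a x y : ℕ) (s : State) : Exec (.store a x y) s 1 (s.setArr a (s.reg x) (s.reg y))
  | seq {p q : Prog} {s s₁ s₂ : State} {t₁ t₂ : ℕ} (h₁ : Exec p s t₁ s₁)
      (h₂ : Exec q s₁ t₂ s₂) : Exec (.seq p q) s (t₁ + t₂) s₂
  | condTrue {x : ℕ} {p q : Prog} {s s₁ : State} {t : ℕ} (hx : s.reg x ≠ 0)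
      (h : Exec p s t s₁) : Exec (.cond x p q) s (t + 1) s₁
  | condFalse {x : ℕ} {p q : Prog} {s s₁ : State} {t : ℕ} (hx : s.reg x = 0)
      (h : Exec q s t s₁) : Exec (.cond x p q) s (t + 1) s₁
  | loopTrue {x : ℕ} {p : Prog} {s s₁ s₂ : State} {t₁ t₂ : ℕ} (hx : s.reg x ≠ 0)
      (h₁ : Exec p s t₁ s₁) (h₂ : Exec (.loop x p) s₁ t₂ s₂) :
      Exec (.loop x p) s (t₁ + t₂ + 1) s₂
  | loopFalse {x : ℕ} {p : Prog} {s : State} (hx : s.reg x = 0) : Exec (.loop x p) s 1 s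

/-- Programs are deterministic, so that the step count and the result of a run are well
defined. -/
theorem Exec.deterministic {p : Prog} {s s₁ s₂ : State} {t₁ t₂ : ℕ}
    (h₁ : Exec p s t₁ s₁) (h₂ : Exec p s t₂ s₂) : t₁ = t₂ ∧ s₁ = s₂ := by
  induction h₁ generalizing t₂ s₂ with
  | const | copy | add | sub | load | store => cases h₂; exact ⟨rfl, rfl⟩
  | seq _ _ ih₁ ih₂ =>
    cases h₂ with
    | seq k₁ k₂ =>
      obtain ⟨rfl, rfl⟩ := ih₁ k₁
      obtain ⟨rfl, rfl⟩ := ih₂ k₂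
      exact ⟨rfl, rfl⟩
  | condTrue hx _ ih =>
    cases h₂ with
    | condTrue _ k => obtain ⟨rfl, rfl⟩ := ih k; exact ⟨rfl, rfl⟩
    | condFalse hx' _ => exact absurd hx' hx
  | condFalse hx _ ih =>
    cases h₂ with
    | condTrue hx' _ => exact absurd hx hx'
    | condFalse _ k => obtain ⟨rfl, rfl⟩ := ih k; exact ⟨rfl, rfl⟩
  | loopTrue hx _ _ ih₁ ih₂ =>
    cases h₂ with
    | loopTrue _ k₁ k₂ =>
      obtain ⟨rfl, rfl⟩ := ih₁ k₁
      obtain ⟨rfl, rfl⟩ := ih₂ k₂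
      exact ⟨rfl, rfl⟩
    | loopFalse hx' => exact absurd hx' hx
  | loopFalse hx =>
    cases h₂ with
    | loopTrue hx' _ _ => exact absurd hx hx'
    | loopFalse _ => exact ⟨rfl, rfl⟩

/-- An algorithm with `k` input words: a program with designated names for its formal
parameters, for the register that tells whether a solution was found, and for the array that
holds this solution. -/
structure Algorithm (k : ℕ) where
  code : Prog
  param : Fin k → ℕ
  param_injective : Function.Injective param
  flag : ℕ
  out : ℕ

/-- The initial memory: the `j`-th input word is stored in the array `param j` and its length in
the register `param j`; everything else is zero. -/
noncomputable def Algorithm.init {k : ℕ} (M : Algorithm k) (w : Fin k → List ℕ) : State where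
  reg := Function.extend M.param (fun j => (w j).length) (fun _ => 0)
  arr := Function.extend M.param (fun j i => (w j).getD i 0) (fun _ _ => 0)

/-- The answer found in the final memory: `none` stands for "infeasible". -/
noncomputable def Algorithm.answer {k : ℕ} (M : Algorithm k) (n : ℕ) (s : State) :
    Option (Fin n → ℝ) :=
  if s.reg M.flag = 0 then none else some fun i => (s.arr M.out i : ℝ)

/-- On input `w` the algorithm halts after exactly `t` steps with answer `r`. -/
def Algorithm.Returns {k n : ℕ} (M : Algorithm k) (w : Fin k → List ℕ) (t : ℕ)
    (r : Option (Fin n → ℝ)) : Prop :=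
  ∃ s, Exec M.code (M.init w) t s ∧ r = M.answer n s

/-- `r` is a correct answer for `max {c·x : x ∈ X}`: an optimal solution, or `none` if the
problem is infeasible. -/
def IsAnswer {n : ℕ} (X : Set (Fin n → ℝ)) (c : Fin n → ℝ) : Option (Fin n → ℝ) → Prop
  | none => X = ∅
  | some x => IsOptimal X c x

/-- On input `w` the algorithm solves `max {c·x : x ∈ X}` in at most `T` steps. -/
def Algorithm.SolvesWithin {k n : ℕ} (M : Algorithm k) (w : Fin k → List ℕ)
    (X : Set (Fin n → ℝ)) (c : Fin n → ℝ) (T : ℕ) : Prop :=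
  ∃ t ≤ T, ∃ r : Option (Fin n → ℝ), M.Returns w t r ∧ IsAnswer X c r

/-- The sequence of leaders as an input word of length `n`. -/
def leaderWord {n : ℕ} (L : Fin n → Fin n) : List ℕ :=
  List.ofFn fun k => (L k : ℕ)

/-- A list of `m` permutations as an input word of length `m * n`: their tables of values, one
after the other. -/
def permWord {m n : ℕ} (g : Fin m → Equiv.Perm (Fin n)) : List ℕ :=
  (List.ofFn fun k => List.ofFn fun i => (g k i : ℕ)).flatten

end SST

namespace SST

/-! ### Time-bounded total correctness of programs -/

/-! Every binary vector can be moved into the cone of the SST cuts by an element of `Γ`. Treat the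
leaders in order. If some `j` in the orbit of the `k`-th leader carries a larger value than the
leader, apply an element of the stabilizer of the earlier leaders that brings the value 1 from `j`
to this leader. Such an element fixes the earlier leaders and maps each of their orbits to itself,
so the cuts already satisfied stay satisfied (`raise_spec`). Applied to an optimal solution, the
resulting element of `Γ` keeps feasibility and objective value. The image is optimal for the smaller
feasible set with cuts, and infeasibility of the program is inherited.

The elements needed must be found from generators in polynomial time. This is the Schreier-Sims
method: a table with `n * n` places stores, for level `k` and point `j`, an element of `Γ` that
fixes the leaders before the `k`-th and maps the `k`-th to `j`. Sifting divides a permutation level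
by level by the representative of its coset, and fills a place where none is known. If all products
of two entries sift through without filling a place, the entries of each level represent all cosets
(`sifts_of_mem_levelGroup`). This happens within `n * n` rounds, because a round that changes the
table fills a place (`round_iterate_eq`). The filled places of level `k` then cover the whole leader
orbit (`exists_of_mem_leaderOrbit`).

On the machine all this consists of nested counting loops, whose step counts are polynomials in `n`
and `m`. The given algorithm runs first, with its names shifted out of the way and the same number
of steps (`Exec.shift`); by the frame property `Exec.agree` it leaves the generators and leaders
intact. -/

@[simp] theorem State.setReg_reg (s : State) (x v r : ℕ) :
    (s.setReg x v).reg r = if r = x then v else s.reg r := by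
  simp [State.setReg, Function.update_apply]

@[simp] theorem State.setReg_arr (s : State) (x v : ℕ) : (s.setReg x v).arr = s.arr := rfl

@[simp] theorem State.setArr_reg (s : State) (a i v : ℕ) : (s.setArr a i v).reg = s.reg := rfl

@[simp] theorem State.setArr_arr (s : State) (a i v b : ℕ) :
    (s.setArr a i v).arr b = if b = a then Function.update (s.arr a) i v else s.arr b := by
  simp [State.setArr, Function.update_apply]

/-- The registers that a program may write. -/
def Prog.wregs : Prog → List ℕ
  | const x _ | copy x _ | add x _ _ | sub x _ _ | load x _ _ => [x]
  | store _ _ _ => []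
  | seq p q | cond _ p q => p.wregs ++ q.wregs
  | loop _ p => p.wregs

/-- The arrays that a program may write. -/
def Prog.warrs : Prog → List ℕ
  | const _ _ | copy _ _ | add _ _ _ | sub _ _ _ | load _ _ _ => []
  | store a _ _ => [a]
  | seq p q | cond _ p q => p.warrs ++ q.warrs
  | loop _ p => p.warrs

/-- `s'` differs from `s` at most in memory that `p` may write. -/
structure Agree (p : Prog) (s s' : State) : Prop where
  reg : ∀ r, r ∉ p.wregs → s'.reg r = s.reg r
  arr : ∀ a, a ∉ p.warrs → s'.arr a = s.arr a

theorem Agree.refl (p : Prog) (s : State) : Agree p s s := ⟨fun _ _ => rfl, fun _ _ => rfl⟩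

theorem Agree.trans {p : Prog} {s s₁ s₂ : State} (h₁ : Agree p s s₁) (h₂ : Agree p s₁ s₂) :
    Agree p s s₂ :=
  ⟨fun r hr => (h₂.reg r hr).trans (h₁.reg r hr), fun a ha => (h₂.arr a ha).trans (h₁.arr a ha)⟩

theorem Agree.mono {p q : Prog} {s s' : State} (h : Agree p s s') (hr : p.wregs ⊆ q.wregs)
    (ha : p.warrs ⊆ q.warrs) : Agree q s s' :=
  ⟨fun r h' => h.reg r fun h'' => h' (hr h''), fun a h' => h.arr a fun h'' => h' (ha h'')⟩

/-- The frame rule: what a run preserves can be read off from the program text, so preservation of a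
concrete register or array is settled by `decide`. -/
theorem Exec.agree {p : Prog} {s s' : State} {t : ℕ} (h : Exec p s t s') : Agree p s s' := by
  induction h with
  | const | copy | add | sub | load =>
    exact ⟨fun r hr => by simp_all [Prog.wregs], fun _ _ => rfl⟩
  | store => exact ⟨fun _ _ => rfl, fun a ha => by simp_all [Prog.warrs]⟩
  | seq _ _ ih₁ ih₂ =>
    exact (ih₁.mono (by simp [Prog.wregs]) (by simp [Prog.warrs])).trans
      (ih₂.mono (by simp [Prog.wregs]) (by simp [Prog.warrs]))
  | condTrue _ _ ih => exact ih.mono (by simp [Prog.wregs]) (by simp [Prog.warrs])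
  | condFalse _ _ ih => exact ih.mono (by simp [Prog.wregs]) (by simp [Prog.warrs])
  | loopTrue _ _ _ ih₁ ih₂ =>
    exact (ih₁.mono (by simp [Prog.wregs]) (by simp [Prog.warrs])).trans ih₂
  | loopFalse => exact Agree.refl _ _

/-- Started in `s`, the program `p` halts after at most `T` steps in a memory satisfying `Q`. -/
def Wp (p : Prog) (T : ℕ) (Q : State → Prop) (s : State) : Prop :=
  ∃ t ≤ T, ∃ s', Exec p s t s' ∧ Q s'

/-! ### Rules for bounding running times -/

namespace Wp

variable {p q : Prog} {T T₁ T₂ : ℕ} {Q Q' : State → Prop} {s : State}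

theorem mono (h : Wp p T₁ Q s) (hT : T₁ ≤ T₂) (hQ : ∀ s', Q s' → Q' s') : Wp p T₂ Q' s :=
  let ⟨t, ht, s', he, hq⟩ := h
  ⟨t, ht.trans hT, s', he, hQ s' hq⟩

theorem le (h : Wp p T₁ Q s) (hT : T₁ ≤ T₂) : Wp p T₂ Q s := h.mono hT fun _ => id

theorem agree (h : Wp p T Q s) (hQ : ∀ s', Agree p s s' → Q s' → Q' s') : Wp p T Q' s :=
  let ⟨t, ht, s', he, hq⟩ := h
  ⟨t, ht, s', he, hQ s' he.agree hq⟩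

theorem const {x v : ℕ} (h : Q (s.setReg x v)) : Wp (.const x v) 1 Q s :=
  ⟨1, le_rfl, _, .const _ _ _, h⟩

theorem add {x y z : ℕ} (h : Q (s.setReg x (s.reg y + s.reg z))) : Wp (.add x y z) 1 Q s :=
  ⟨1, le_rfl, _, .add _ _ _ _, h⟩

theorem sub {x y z : ℕ} (h : Q (s.setReg x (s.reg y - s.reg z))) : Wp (.sub x y z) 1 Q s :=
  ⟨1, le_rfl, _, .sub _ _ _ _, h⟩

theorem load {x a y : ℕ} (h : Q (s.setReg x (s.arr a (s.reg y)))) : Wp (.load x a y) 1 Q s :=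
  ⟨1, le_rfl, _, .load _ _ _ _, h⟩

theorem store {a x y : ℕ} (h : Q (s.setArr a (s.reg x) (s.reg y))) : Wp (.store a x y) 1 Q s :=
  ⟨1, le_rfl, _, .store _ _ _ _, h⟩

theorem seq (h : Wp p T₁ (Wp q T₂ Q) s) : Wp (.seq p q) (T₁ + T₂) Q s :=
  let ⟨_, ht₁, _, he₁, _, ht₂, s₂, he₂, hq⟩ := h
  ⟨_, add_le_add ht₁ ht₂, s₂, he₁.seq he₂, hq⟩

/-- Paying for both branches is wasteful but keeps the bounds free of maxima, hence built from sums
and products only. -/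
theorem cond {x : ℕ} (h₁ : s.reg x ≠ 0 → Wp p T₁ Q s) (h₂ : s.reg x = 0 → Wp q T₂ Q s) :
    Wp (.cond x p q) (T₁ + T₂ + 1) Q s := by
  by_cases hx : s.reg x = 0
  · obtain ⟨t, ht, s', he, hq⟩ := h₂ hx
    exact ⟨t + 1, by omega, s', .condFalse hx he, hq⟩
  · obtain ⟨t, ht, s', he, hq⟩ := h₁ hx
    exact ⟨t + 1, by omega, s', .condTrue hx he, hq⟩

end Wp

/-- `for (i := 0; i < lim; i := i + st) body`, where register `3` is used for the test. -/
def Prog.forLoop (i lim st : ℕ) (body : Prog) : Prog :=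
  .seq (.const i 0) (.seq (.sub 3 lim i)
    (.loop 3 (.seq body (.seq (.add i i st) (.sub 3 lim i)))))

section forLoop

variable {i lim st cnt v B : ℕ} {body : Prog} {s : State}

/-- Each pass costs the body plus three steps: loop test, increment, new guard. The invariant may
speak of registers as long as it ignores the counter and the guard, which the loop itself
overwrites. -/
theorem Wp.forLoop_of_stable {Inv : ℕ → State → Prop} (hi : i ≠ 3)
    (hw : i ∉ body.wregs ∧ lim ∉ (Prog.forLoop i lim st body).wregs ∧
      st ∉ (Prog.forLoop i lim st body).wregs)
    (hlim : s.reg lim = cnt * v) (hst : s.reg st = v) (hv : 0 < v)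
    (hstable : ∀ k s w r, r = i ∨ r = 3 → Inv k s → Inv k (s.setReg r w))
    (h0 : Inv 0 s)
    (hb : ∀ k < cnt, ∀ s₁, Agree (.forLoop i lim st body) s s₁ → s₁.reg i = k * v →
      Inv k s₁ → Wp body B (Inv (k + 1)) s₁) :
    Wp (.forLoop i lim st body) (cnt * (B + 3) + 3) (Inv cnt) s := by
  -- Induction on the number `d` of remaining passes. The guard holds the distance `d * v` from
  -- counter to limit, so it vanishes exactly at the end.
  have key : ∀ d k, k + d = cnt → ∀ s₁, Agree (.forLoop i lim st body) s s₁ →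
      s₁.reg i = k * v → s₁.reg 3 = d * v → Inv k s₁ →
      Wp (.loop 3 (.seq body (.seq (.add i i st) (.sub 3 lim i)))) (d * (B + 3) + 1)
        (Inv cnt) s₁ := by
    intro d
    induction d with
    | zero =>
      rintro k rfl s₁ - - h3 hI
      exact ⟨1, by omega, s₁, .loopFalse (by simpa using h3), hI⟩
    | succ d ih =>
      intro k hk s₁ hA hki h3 hI
      obtain ⟨t, ht, s₂, he, hI'⟩ := hb k (by omega) s₁ hA hki hI
      have hA₂ : Agree (.forLoop i lim st body) s s₂ := hA.trans
        (he.agree.mono (fun _ h => by simp [Prog.forLoop, Prog.wregs, h])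
          (fun _ h => by simp [Prog.forLoop, Prog.warrs, h]))
      have hi₂ : s₂.reg i = k * v := (he.agree.reg i hw.1).trans hki
      have hlim₂ : s₂.reg lim = cnt * v := (hA₂.reg lim hw.2.1).trans hlim
      have hst₂ : s₂.reg st = v := (hA₂.reg st hw.2.2).trans hst
      have hli : lim ≠ i := fun h => hw.2.1 (by simp [Prog.forLoop, Prog.wregs, h])
      set s₃ := s₂.setReg i (s₂.reg i + s₂.reg st) with hs₃
      set s₄ := s₃.setReg 3 (s₃.reg lim - s₃.reg i) with hs₄
      obtain ⟨t', ht', s₅, he', hI''⟩ := ih (k + 1) (by omega) s₄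
        (hA₂.trans ⟨fun r hr => by
            have h1 : r ≠ i := fun h => hr (by simp [Prog.forLoop, Prog.wregs, h])
            have h2 : r ≠ 3 := fun h => hr (by simp [Prog.forLoop, Prog.wregs, h])
            simp [hs₄, hs₃, h1, h2], fun _ _ => rfl⟩)
        (by simp [hs₄, hs₃, hi, hi₂, hst₂]; ring)
        (by
          have : s₄.reg 3 = s₃.reg lim - s₃.reg i := by simp [hs₄]
          rw [this]
          simp only [hs₃, State.setReg_reg, hli, if_false, if_true, hlim₂, hi₂, hst₂, ← hk]
          rw [show (k + (d + 1)) * v = (k * v + v) + d * v by ring]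
          omega)
        (hstable _ _ _ _ (.inr rfl) (hstable _ _ _ _ (.inl rfl) hI'))
      refine ⟨_, ?_, s₅, .loopTrue (by rw [h3]; positivity)
        (he.seq ((Exec.add _ _ _ _).seq (.sub _ _ _ _))) he', hI''⟩
      have : (d + 1) * (B + 3) = d * (B + 3) + (B + 3) := by ring
      omega
  refine (Wp.seq (T₂ := 1 + (cnt * (B + 3) + 1)) (Wp.const ?_)).le (by omega)
  refine Wp.seq (Wp.sub ?_)
  have hli : lim ≠ i := fun h => hw.2.1 (by simp [Prog.forLoop, Prog.wregs, h])
  refine key cnt 0 (by simp) _ ⟨fun r hr => ?_, fun _ _ => rfl⟩ (by simp [hi])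
    (by simp [hli, hlim]) (hstable _ _ _ _ (.inr rfl) (hstable _ _ _ _ (.inl rfl) h0))
  have h1 : r ≠ i := fun h => hr (by simp [Prog.forLoop, Prog.wregs, h])
  have h2 : r ≠ 3 := fun h => hr (by simp [Prog.forLoop, Prog.wregs, h])
  simp [h1, h2]

/-- The loop rule for invariants on the arrays; registers that the loop does not write are taken
care of by the frame `Agree`. -/
theorem Wp.forLoop {Inv : ℕ → (ℕ → ℕ → ℕ) → Prop} (hi : i ≠ 3)
    (hw : i ∉ body.wregs ∧ lim ∉ (Prog.forLoop i lim st body).wregs ∧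
      st ∉ (Prog.forLoop i lim st body).wregs)
    (hlim : s.reg lim = cnt * v) (hst : s.reg st = v) (hv : 0 < v)
    (h0 : Inv 0 s.arr)
    (hb : ∀ k < cnt, ∀ s₁, Agree (.forLoop i lim st body) s s₁ → s₁.reg i = k * v →
      Inv k s₁.arr → Wp body B (fun s₂ => Inv (k + 1) s₂.arr) s₁) :
    Wp (.forLoop i lim st body) (cnt * (B + 3) + 3) (fun s' => Inv cnt s'.arr) s :=
  Wp.forLoop_of_stable (Inv := fun k s => Inv k s.arr) hi hw hlim hst hv
    (fun _ _ _ _ _ h => h) h0 hb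

end forLoop

/-! ### Renaming of registers and arrays -/

/-- Shift all names by `C`. -/
def Prog.shift (C : ℕ) : Prog → Prog
  | const x v => const (x + C) v
  | copy x y => copy (x + C) (y + C)
  | add x y z => add (x + C) (y + C) (z + C)
  | sub x y z => sub (x + C) (y + C) (z + C)
  | load x a y => load (x + C) (a + C) (y + C)
  | store a x y => store (a + C) (x + C) (y + C)
  | seq p q => seq (p.shift C) (q.shift C)
  | cond x p q => cond (x + C) (p.shift C) (q.shift C)
  | loop x p => loop (x + C) (p.shift C)

/-- `s'` contains the memory `s`, with all names shifted by `C`. -/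
structure Embeds (C : ℕ) (s s' : State) : Prop where
  reg : ∀ x, s'.reg (x + C) = s.reg x
  arr : ∀ a, s'.arr (a + C) = s.arr a

theorem Embeds.setReg {C : ℕ} {s s' : State} (h : Embeds C s s') (x v : ℕ) :
    Embeds C (s.setReg x v) (s'.setReg (x + C) v) :=
  ⟨fun y => by simp [h.reg], h.arr⟩

theorem Embeds.setArr {C : ℕ} {s s' : State} (h : Embeds C s s') (a i v : ℕ) :
    Embeds C (s.setArr a i v) (s'.setArr (a + C) i v) :=
  ⟨h.reg, fun y => by simp [h.arr]⟩

/-- Renaming is a step-by-step simulation, so even the exact step count is kept. -/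
theorem Exec.shift {C : ℕ} {p : Prog} {s s₁ : State} {t : ℕ} (h : Exec p s t s₁) :
    ∀ s', Embeds C s s' → ∃ s₁', Exec (p.shift C) s' t s₁' ∧ Embeds C s₁ s₁' := by
  induction h with
  | const x v s => exact fun s' e => ⟨_, .const _ _ _, e.setReg x v⟩
  | copy x y s =>
    exact fun s' e => ⟨_, .copy _ _ _, by simpa [e.reg] using e.setReg x (s.reg y)⟩
  | add x y z s =>
    exact fun s' e => ⟨_, .add _ _ _ _, by simpa [e.reg] using e.setReg x (s.reg y + s.reg z)⟩
  | sub x y z s =>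
    exact fun s' e => ⟨_, .sub _ _ _ _, by simpa [e.reg] using e.setReg x (s.reg y - s.reg z)⟩
  | load x a y s =>
    exact fun s' e => ⟨_, .load _ _ _ _,
      by simpa [e.reg, e.arr] using e.setReg x (s.arr a (s.reg y))⟩
  | store a x y s =>
    exact fun s' e => ⟨_, .store _ _ _ _,
      by simpa [e.reg] using e.setArr a (s.reg x) (s.reg y)⟩
  | seq _ _ ih₁ ih₂ =>
    intro s' e
    obtain ⟨s₁', h₁, e₁⟩ := ih₁ s' e
    obtain ⟨s₂', h₂, e₂⟩ := ih₂ s₁' e₁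
    exact ⟨s₂', h₁.seq h₂, e₂⟩
  | condTrue hx _ ih =>
    intro s' e
    obtain ⟨s₁', h₁, e₁⟩ := ih s' e
    exact ⟨s₁', .condTrue (by rwa [e.reg]) h₁, e₁⟩
  | condFalse hx _ ih =>
    intro s' e
    obtain ⟨s₁', h₁, e₁⟩ := ih s' e
    exact ⟨s₁', .condFalse (by rwa [e.reg]) h₁, e₁⟩
  | loopTrue hx _ _ ih₁ ih₂ =>
    intro s' e
    obtain ⟨s₁', h₁, e₁⟩ := ih₁ s' e
    obtain ⟨s₂', h₂, e₂⟩ := ih₂ s₁' e₁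
    exact ⟨s₂', .loopTrue (by rwa [e.reg]) h₁ h₂, e₂⟩
  | loopFalse hx => exact fun s' e => ⟨s', .loopFalse (by rwa [e.reg]), e⟩

theorem Prog.le_of_mem_wregs_shift {C : ℕ} {p : Prog} {r : ℕ} (h : r ∈ (p.shift C).wregs) :
    C ≤ r := by
  induction p with
  | const | copy | add | sub | load | store => simp [shift, wregs] at h; try omega
  | seq p q ihp ihq => simp [shift, wregs] at h; tauto
  | cond x p q ihp ihq => simp [shift, wregs] at h; tauto
  | loop x p ih => exact ih h

theorem Prog.le_of_mem_warrs_shift {C : ℕ} {p : Prog} {a : ℕ} (h : a ∈ (p.shift C).warrs) :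
    C ≤ a := by
  induction p with
  | const | copy | add | sub | load | store => simp [shift, warrs] at h; try omega
  | seq p q ihp ihq => simp [shift, warrs] at h; tauto
  | cond x p q ihp ihq => simp [shift, warrs] at h; tauto
  | loop x p ih => exact ih h


/-! ### Bounded iteration -/

/-- `f (k - 1) (… (f 1 (f 0 a)))`, where steps from `n` on are void. -/
def iter {α : Type*} {n : ℕ} (f : Fin n → α → α) : ℕ → α → α
  | 0, a => a
  | k + 1, a => if h : k < n then f ⟨k, h⟩ (iter f k a) else iter f k a

section iter

variable {α : Type*} {n : ℕ} {f : Fin n → α → α}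

theorem iter_succ {k : ℕ} (h : k < n) (a : α) : iter f (k + 1) a = f ⟨k, h⟩ (iter f k a) := by
  simp [iter, h]

theorem iter_induction {p : ℕ → α → Prop} {a : α} (h0 : p 0 a)
    (hs : ∀ (k : Fin n) b, p k b → p (k + 1) (f k b)) : ∀ k ≤ n, p k (iter f k a)
  | 0, _ => h0
  | k + 1, h => by
    rw [iter_succ h]
    exact hs ⟨k, h⟩ _ (iter_induction h0 hs k (by omega))

theorem iter_rel {r : α → α → Prop} (hrefl : ∀ a, r a a)
    (htrans : ∀ {a b c}, r a b → r b c → r a c) (hf : ∀ k a, r a (f k a)) (a : α) {j k : ℕ}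
    (hjk : j ≤ k) (hk : k ≤ n) : r (iter f j a) (iter f k a) := by
  induction k, hjk using Nat.le_induction with
  | base => exact hrefl _
  | succ k _ ih =>
    rw [iter_succ hk]
    exact htrans (ih (by omega)) (hf _ _)

/-- A chain increasing for an antisymmetric relation that returns to its start never moved, so every
single step was void. -/
theorem iter_fixed {r : α → α → Prop} (hrefl : ∀ a, r a a)
    (htrans : ∀ {a b c}, r a b → r b c → r a c) (hanti : ∀ {a b}, r a b → r b a → a = b)
    (hf : ∀ k a, r a (f k a)) {a : α} (h : iter f n a = a) (k : Fin n) : f k a = a := by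
  have hfix : ∀ k ≤ n, iter f k a = a := fun k hk => by
    have h1 := iter_rel hrefl htrans hf a (Nat.zero_le k) hk
    have h2 := iter_rel hrefl htrans hf a hk le_rfl
    rw [h] at h2
    exact hanti h2 h1
  have := iter_succ (f := f) k.2 a
  rw [hfix _ k.2, hfix _ k.2.le] at this
  exact this.symm

/-- Each application that is not void raises a measure bounded by `n`. Hence after `n` applications
either a fixed point was met or the measure is at its maximum, and the next application is void. -/
theorem iter_const_fixed {g : α → α} {p : α → Prop} {μ : α → ℕ} (hp : ∀ a, p a → p (g a))
    (hle : ∀ a, p a → μ a ≤ n) (hlt : ∀ a, p a → g a = a ∨ μ a < μ (g a)) {a : α} (ha : p a) :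
    g (iter (fun _ : Fin n => g) n a) = iter (fun _ : Fin n => g) n a := by
  have key : ∀ k ≤ n, p (iter (fun _ : Fin n => g) k a) ∧
      (g (iter (fun _ : Fin n => g) k a) = iter (fun _ : Fin n => g) k a ∨
        k ≤ μ (iter (fun _ : Fin n => g) k a)) := by
    refine iter_induction (p := fun k b => p b ∧ (g b = b ∨ k ≤ μ b))
      ⟨ha, .inr (Nat.zero_le _)⟩ ?_
    rintro k b ⟨hb, h⟩
    refine ⟨hp b hb, ?_⟩
    rcases h with h | h
    · left; rw [h, h]
    · rcases hlt b hb with h' | h'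
      · left; rw [h', h']
      · right; omega
  obtain ⟨hb, h | h⟩ := key n le_rfl
  · exact h
  · rcases hlt _ hb with h' | h'
    · exact h'
    · have := hle _ (hp _ hb)
      omega

end iter

/-! ### Tables of coset representatives -/

variable {n : ℕ}

/-- The place in the table of the representative that maps the `k`-th leader to `j`. -/
def slot (k j : Fin n) : ℕ := k * n + j

theorem slot_lt (k j : Fin n) : slot k j < n * n := by
  have hk := k.2
  have hj := j.2
  calc slot k j < k * n + n := by simp [slot]
    _ = (k + 1) * n := by ring
    _ ≤ n * n := Nat.mul_le_mul_right n hk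

theorem slot_injective {k j k' j' : Fin n} (h : slot k j = slot k' j') : k = k' ∧ j = j' := by
  have hn : 0 < n := k.pos
  have hk := congrArg (· / n) h
  have hj := congrArg (· % n) h
  simp only [slot] at hk hj
  rw [mul_comm, Nat.mul_add_div hn, Nat.div_eq_of_lt j.2, mul_comm, Nat.mul_add_div hn,
    Nat.div_eq_of_lt j'.2] at hk
  rw [mul_comm, Nat.mul_add_mod, Nat.mod_eq_of_lt j.2, mul_comm, Nat.mul_add_mod,
    Nat.mod_eq_of_lt j'.2] at hj
  exact ⟨Fin.ext (by simpa using hk), Fin.ext hj⟩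

/-- A partial table of permutations. -/
abbrev Table (n : ℕ) := ℕ → Option (Equiv.Perm (Fin n))

/-- `T'` extends `T`. -/
def Table.Ext (T T' : Table n) : Prop := ∀ e u, T e = some u → T' e = some u

theorem Table.Ext.refl (T : Table n) : T.Ext T := fun _ _ => id

theorem Table.Ext.trans {T T' T'' : Table n} (h : T.Ext T') (h' : T'.Ext T'') : T.Ext T'' :=
  fun e u hu => h' e u (h e u hu)

theorem Table.Ext.antisymm {T T' : Table n} (h : T.Ext T') (h' : T'.Ext T) : T = T' := by
  funext e
  exact Option.ext fun u => ⟨h e u, h' e u⟩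

/-- One level of sifting: divide `h` by the representative of its coset, which is `h` itself if
the table has none so far. -/
def siftStep (L : Fin n → Fin n) (k : Fin n) (a : Table n × Equiv.Perm (Fin n)) :
    Table n × Equiv.Perm (Fin n) :=
  match a.1 (slot k (a.2 (L k))) with
  | some u => (a.1, u⁻¹ * a.2)
  | none => (Function.update a.1 (slot k (a.2 (L k))) (some a.2), 1)

/-- Sift `h` through the table `T`. -/
def sift (L : Fin n → Fin n) (T : Table n) (h : Equiv.Perm (Fin n)) : Table n :=
  (iter (siftStep L) n (T, h)).1

/-- Sift the products of all pairs of table entries. -/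
def round (L : Fin n → Fin n) (T : Table n) : Table n :=
  iter (fun e : Fin (n * n) => iter (fun e' : Fin (n * n) => fun T : Table n =>
    sift L T ((T e).getD 1 * (T e').getD 1)) (n * n)) (n * n) T

/-- The complete table for the group generated by `g`. -/
def fullTable {m : ℕ} (L : Fin n → Fin n) (g : Fin m → Equiv.Perm (Fin n)) : Table n :=
  iter (fun _ : Fin (n * n) => round L) (n * n)
    (iter (fun (q : Fin m) T => sift L T (g q)) m (sift L (fun _ => none) 1))

/-- Entries at `slot k j` lie in `Γ`, fix the leaders before the `k`-th and map this to `j`. -/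
structure Table.Valid (L : Fin n → Fin n) (Γ : Subgroup (Equiv.Perm (Fin n))) (T : Table n) :
    Prop where
  lt : ∀ e u, T e = some u → e < n * n
  mem : ∀ e u, T e = some u → u ∈ Γ
  map : ∀ k j u, T (slot k j) = some u → u (L k) = j
  fix : ∀ k j u, T (slot k j) = some u → ∀ i < k, u (L i) = L i

variable {L : Fin n → Fin n} {Γ : Subgroup (Equiv.Perm (Fin n))} {T T' : Table n}

/-- `h` is a product of representatives from the levels `k, …, n - 1`. -/
inductive Sifts (L : Fin n → Fin n) (T : Table n) : ℕ → Equiv.Perm (Fin n) → Prop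
  | one : Sifts L T n 1
  | step (k : Fin n) (h u : Equiv.Perm (Fin n)) : T (slot k (h (L k))) = some u →
      Sifts L T (k + 1) (u⁻¹ * h) → Sifts L T k h

theorem Sifts.mono (hT : T.Ext T') {k : ℕ} {h : Equiv.Perm (Fin n)} (hs : Sifts L T k h) :
    Sifts L T' k h := by
  induction hs with
  | one => exact .one
  | step k h u hu _ ih => exact .step k h u (hT _ _ hu) ih

theorem siftStep_ext (k : Fin n) (a : Table n × Equiv.Perm (Fin n)) :
    a.1.Ext (siftStep L k a).1 := by
  unfold siftStep
  split
  · exact Table.Ext.refl _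
  · rename_i heq
    intro e u hu
    have : e ≠ slot k (a.2 (L k)) := by rintro rfl; simp [heq] at hu
    simpa [Function.update_apply, this] using hu

theorem sift_ext (T : Table n) (h : Equiv.Perm (Fin n)) : T.Ext (sift L T h) :=
  iter_rel (r := fun a b : Table n × Equiv.Perm (Fin n) => Table.Ext a.1 b.1)
    (fun _ => Table.Ext.refl _) (fun h h' => h.trans h') siftStep_ext (T, h) (Nat.zero_le n)
    le_rfl

theorem Table.iter_ext {N : ℕ} {f : Fin N → Table n → Table n} (hf : ∀ k T, Table.Ext T (f k T))
    (T : Table n) : T.Ext (iter f N T) :=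
  iter_rel (r := Table.Ext) (fun _ => Table.Ext.refl _) (fun h h' => h.trans h') hf T
    (Nat.zero_le N) le_rfl

theorem round_ext (T : Table n) : T.Ext (round L T) :=
  Table.iter_ext (fun _ => Table.iter_ext fun _ _ => sift_ext _ _) T

/-- What sifting preserves at level `k`. -/
structure SiftInv (L : Fin n → Fin n) (Γ : Subgroup (Equiv.Perm (Fin n))) (k : ℕ)
    (a : Table n × Equiv.Perm (Fin n)) : Prop where
  valid : a.1.Valid L Γ
  mem : a.2 ∈ Γ
  fix : ∀ i : Fin n, (i : ℕ) < k → a.2 (L i) = L i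

/-- The divisor `u` agrees with `h` on the `k`-th leader and both fix the earlier ones, so `u⁻¹ * h`
fixes one leader more. -/
theorem SiftInv.siftStep {k : Fin n} {a : Table n × Equiv.Perm (Fin n)}
    (h : SiftInv L Γ k a) : SiftInv L Γ (k + 1) (siftStep L k a) := by
  unfold SST.siftStep
  split
  · rename_i u hu
    refine ⟨h.valid, Γ.mul_mem (Γ.inv_mem (h.valid.mem _ _ hu)) h.mem, fun i hi => ?_⟩
    rw [Equiv.Perm.mul_apply, Equiv.Perm.inv_eq_iff_eq]
    rcases Nat.lt_succ_iff_lt_or_eq.1 hi with hi | hi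
    · rw [h.fix i hi, h.valid.fix _ _ _ hu i hi]
    · obtain rfl := Fin.ext hi
      exact (h.valid.map _ _ _ hu).symm
  · refine ⟨⟨fun e u hu => ?_, fun e u hu => ?_, fun k' j u hu => ?_, fun k' j u hu => ?_⟩,
      Γ.one_mem, fun _ _ => rfl⟩ <;>
    simp only [Function.update_apply] at hu <;> split at hu
    · rename_i heq; subst heq; exact slot_lt _ _
    · exact h.valid.lt _ _ hu
    · cases hu; exact h.mem
    · exact h.valid.mem _ _ hu
    · rename_i heq
      obtain ⟨rfl, rfl⟩ := slot_injective heq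
      cases hu; rfl
    · exact h.valid.map _ _ _ hu
    · rename_i heq
      obtain ⟨rfl, rfl⟩ := slot_injective heq
      cases hu; exact h.fix
    · exact h.valid.fix _ _ _ hu

theorem SiftInv.iter (hT : T.Valid L Γ) {h : Equiv.Perm (Fin n)} (hh : h ∈ Γ) :
    ∀ k ≤ n, SiftInv L Γ k (iter (SST.siftStep L) k (T, h)) :=
  iter_induction ⟨hT, hh, fun _ hi => absurd hi (Nat.not_lt_zero _)⟩ fun _ _ => SiftInv.siftStep

theorem Table.Valid.sift (hT : T.Valid L Γ) {h : Equiv.Perm (Fin n)} (hh : h ∈ Γ) :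
    (sift L T h).Valid L Γ :=
  (SiftInv.iter hT hh n le_rfl).valid

/-- Both cases become one: a newly inserted `h` is its own divisor, since `h⁻¹ * h = 1`. -/
theorem siftStep_spec (k : Fin n) (a : Table n × Equiv.Perm (Fin n)) :
    ∃ u, (siftStep L k a).1 (slot k (a.2 (L k))) = some u ∧ (siftStep L k a).2 = u⁻¹ * a.2 := by
  unfold siftStep
  split
  · rename_i u hu
    exact ⟨u, hu, rfl⟩
  · exact ⟨a.2, by simp, by simp⟩

/-- After all levels the residue fixes every leader, and every point is a leader, so the residue is
1. The divisors used on the way persist in the final table because sifting only extends it. -/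
theorem sifts_sift (hL : Function.Surjective L) (hT : T.Valid L Γ) {h : Equiv.Perm (Fin n)}
    (hh : h ∈ Γ) : Sifts L (sift L T h) 0 h := by
  have key : ∀ d k, k + d = n → Sifts L (sift L T h) k (iter (siftStep L) k (T, h)).2 := by
    intro d
    induction d with
    | zero =>
      rintro k rfl
      have : (iter (siftStep L) k (T, h)).2 = 1 := by
        ext i
        obtain ⟨i, rfl⟩ := hL i
        rw [(SiftInv.iter hT hh k le_rfl).fix i i.2]
        rfl
      rw [this]
      exact .one
    | succ d ih =>
      intro k hk
      have hkn : k < n := by omega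
      obtain ⟨u, hu, hu'⟩ := siftStep_spec (L := L) ⟨k, hkn⟩ (iter (siftStep L) k (T, h))
      have hs := ih (k + 1) (by omega)
      rw [iter_succ hkn, hu'] at hs
      refine .step ⟨k, hkn⟩ _ u ?_ hs
      rw [← iter_succ (f := siftStep L) hkn] at hu
      exact iter_rel (r := fun a b : Table n × Equiv.Perm (Fin n) => Table.Ext a.1 b.1)
        (fun _ => Table.Ext.refl _) (fun h h' => h.trans h') siftStep_ext (T, h) hkn le_rfl _ _ hu
  exact key n 0 (by simp)

/-- The table contains the trivial representatives. -/
def Table.Unital (L : Fin n → Fin n) (T : Table n) : Prop := ∀ k, T (slot k (L k)) = some 1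

theorem Table.Unital.mono (hT : T.Unital L) (h : T.Ext T') : T'.Unital L := fun k => h _ _ (hT k)

theorem unital_sift_one : (sift L (fun _ => none) 1).Unital L := by
  have key := iter_induction (f := siftStep L) (a := ((fun _ => none : Table n), 1))
    (p := fun k a => (∀ e u, a.1 e = some u → u = 1) ∧ a.2 = 1 ∧
      ∀ i : Fin n, (i : ℕ) < k → a.1 (slot i (L i)) = some 1)
    ⟨by simp, rfl, by simp⟩ ?_ n le_rfl
  · exact fun k => key.2.2 k k.2
  · rintro k ⟨T, h⟩ ⟨h1, rfl, h2⟩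
    dsimp only at h1 h2
    unfold siftStep
    split
    · rename_i u hu
      obtain rfl := h1 _ _ hu
      refine ⟨h1, by simp, fun i hi => ?_⟩
      rcases Nat.lt_succ_iff_lt_or_eq.1 hi with hi | hi
      · exact h2 i hi
      · obtain rfl := Fin.ext hi
        exact hu
    · refine ⟨fun e u hu => ?_, rfl, fun i hi => ?_⟩
      · simp only [Function.update_apply] at hu
        split at hu
        · cases hu; rfl
        · exact h1 _ _ hu
      · simp only [Function.update_apply]
        split
        · rfl
        · rename_i hne
          rcases Nat.lt_succ_iff_lt_or_eq.1 hi with hi | hi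
          · exact h2 i hi
          · obtain rfl := Fin.ext hi
            exact absurd rfl hne

/-- At a level whose leader is fixed by `h`, the divisor is the trivial representative, so that
level can be skipped. -/
theorem Sifts.of_fix (hT : T.Unital L) {h : Equiv.Perm (Fin n)} (hs : Sifts L T 0 h) :
    ∀ k ≤ n, (∀ i : Fin n, (i : ℕ) < k → h (L i) = L i) → Sifts L T k h := by
  intro k
  induction k with
  | zero => exact fun _ _ => hs
  | succ k ih =>
    intro hk hfix
    have := ih (by omega) fun i hi => hfix i (by omega)
    generalize hk' : k = k' at this
    cases this with
    | one => omega
    | step k₀ h u hu hs =>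
      subst hk'
      rw [hfix k₀ (by omega), hT k₀] at hu
      cases hu
      simpa using hs

/-- The subgroup generated by the representatives from the levels `k, …, n - 1`. -/
def levelGroup (T : Table n) (k : ℕ) : Subgroup (Equiv.Perm (Fin n)) :=
  Subgroup.closure {u | ∃ i j : Fin n, k ≤ i ∧ T (slot i j) = some u}

theorem Sifts.mem_levelGroup {k : ℕ} {h : Equiv.Perm (Fin n)} (hs : Sifts L T k h) :
    h ∈ levelGroup T k := by
  induction hs with
  | one => exact Subgroup.one_mem _
  | step k h u hu _ ih =>
    have h1 : u ∈ levelGroup T k := Subgroup.subset_closure ⟨k, _, le_rfl, hu⟩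
    have h2 : levelGroup T (k + 1) ≤ levelGroup T k :=
      Subgroup.closure_mono fun u ⟨i, j, hi, hu⟩ => ⟨i, j, by omega, hu⟩
    simpa using Subgroup.mul_mem _ h1 (h2 ih)

theorem Table.Valid.fix_of_mem_levelGroup (hT : T.Valid L Γ) {k : ℕ} {h : Equiv.Perm (Fin n)}
    (hh : h ∈ levelGroup T k) (i : Fin n) (hi : (i : ℕ) < k) : h (L i) = L i := by
  have : levelGroup T k ≤ MulAction.stabilizer (Equiv.Perm (Fin n)) (L i) := by
    refine (Subgroup.closure_le _).2 ?_
    rintro u ⟨i', j, hi', hu⟩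
    exact hT.fix _ _ _ hu i (Fin.lt_def.2 (by omega))
  exact this hh

/-- A table is complete if all products of two of its entries sift through it. -/
theorem sifts_of_mem_levelGroup (hT : T.Valid L Γ) (h1 : T.Unital L)
    (hc : ∀ (k j k' j' : Fin n) u u', T (slot k j) = some u → T (slot k' j') = some u' →
      Sifts L T 0 (u * u')) :
    ∀ d k, k + d = n → ∀ h ∈ levelGroup T k, Sifts L T k h := by
  intro d
  induction d with
  | zero =>
    rintro k rfl h hh
    have : levelGroup T k = ⊥ := by
      refine Subgroup.closure_eq_bot_iff.2 ?_
      rintro u ⟨i, j, hi, -⟩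
      exact absurd i.2 (by omega)
    rw [this, Subgroup.mem_bot] at hh
    subst hh
    exact .one
  | succ d ih =>
    intro k hk h hh
    have hkn : k < n := by omega
    let κ : Fin n := ⟨k, hkn⟩
    -- The union of the cosets of the next level group by the representatives of level `k`. It is
    -- shown to be closed under left multiplication by generators of the level group and their
    -- inverses, so it contains that group.
    let Q : Set (Equiv.Perm (Fin n)) :=
      {h | ∃ j u w, T (slot κ j) = some u ∧ w ∈ levelGroup T (k + 1) ∧ h = u * w}
    have hmul : ∀ g, (∃ i j : Fin n, k ≤ i ∧ T (slot i j) = some g) → ∀ h ∈ Q, g * h ∈ Q := by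
      rintro g ⟨i, j, hi, hg⟩ _ ⟨j', u, w, hu, hw, rfl⟩
      have hs := (hc _ _ _ _ _ _ hg hu).of_fix h1 k hkn.le fun i' hi' => by
        rw [Equiv.Perm.mul_apply, hT.fix _ _ _ hu i' hi',
          hT.fix _ _ _ hg i' (Fin.lt_def.2 (by omega))]
      generalize hk' : k = k' at hs
      generalize hx : g * u = x at hs
      cases hs with
      | one => omega
      | step k₀ _ v hv hs =>
        obtain rfl : κ = k₀ := Fin.ext hk'
        -- The product of generator and representative sifts from level `k` on, with first divisor
        -- `v`; the rest lies in the next level group and absorbs `w`.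
        refine ⟨_, v, v⁻¹ * x * w, hv, Subgroup.mul_mem _ hs.mem_levelGroup hw, ?_⟩
        rw [← mul_assoc, hx]; group
    have hmul' : ∀ g, (∃ i j : Fin n, k ≤ i ∧ T (slot i j) = some g) →
        ∀ h ∈ Q, g⁻¹ * h ∈ Q := by
      intro g hg h hh
      -- The group is finite, so the inverse of a generator is a power of it.
      have hpow : ∀ r : ℕ, g ^ r * h ∈ Q := by
        intro r
        induction r with
        | zero => simpa using hh
        | succ r ihr => rw [pow_succ', mul_assoc]; exact hmul g hg _ ihr
      have : g⁻¹ = g ^ (orderOf g - 1) := by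
        rw [inv_eq_iff_mul_eq_one, ← pow_succ', Nat.sub_add_cancel (orderOf_pos g),
          pow_orderOf_eq_one]
      rw [this]
      exact hpow _
    have hQ : h ∈ Q := by
      refine Subgroup.closure_induction_left (p := fun h _ => h ∈ Q) ?_ ?_ ?_ hh
      · exact ⟨L κ, 1, 1, h1 κ, Subgroup.one_mem _, by simp⟩
      · exact fun g hg h _ hh => hmul g hg h hh
      · exact fun g hg h _ hh => hmul' g hg h hh
    obtain ⟨j, u, w, hu, hw, rfl⟩ := hQ
    refine .step κ _ u ?_ (by simpa [κ] using ih (k + 1) (by omega) w hw)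
    rw [Equiv.Perm.mul_apply, hT.fix_of_mem_levelGroup hw κ (Nat.lt_succ_self k),
      hT.map _ _ _ hu]
    exact hu

/-! ### Stabilization of the rounds of sifting -/

theorem Table.Valid.getD_mem (hT : T.Valid L Γ) (e : ℕ) : (T e).getD 1 ∈ Γ := by
  cases h : T e with
  | none => exact Γ.one_mem
  | some u => exact hT.mem e u h

theorem Table.Valid.iter {N : ℕ} {f : Fin N → Table n → Table n}
    (hf : ∀ k T, T.Valid L Γ → (f k T).Valid L Γ) (hT : T.Valid L Γ) :
    (iter f N T).Valid L Γ :=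
  iter_induction (p := fun _ T => T.Valid L Γ) hT (fun k T => hf k T) N le_rfl

theorem Table.Valid.round (hT : T.Valid L Γ) : (round L T).Valid L Γ :=
  Table.Valid.iter (fun _ _ h => Table.Valid.iter
    (fun _ _ h => h.sift (Γ.mul_mem (h.getD_mem _) (h.getD_mem _))) h) hT

/-- If a round changes nothing, then by antisymmetry of table extension each single sift in it
changed nothing, so the product sifts through `T` itself. -/
theorem sifts_of_round_eq (hL : Function.Surjective L) (hT : T.Valid L Γ)
    (h : SST.round L T = T) (k j k' j' : Fin n) (u u' : Equiv.Perm (Fin n))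
    (hu : T (slot k j) = some u) (hu' : T (slot k' j') = some u') : Sifts L T 0 (u * u') := by
  have h1 := iter_fixed (r := Table.Ext) (fun _ => Table.Ext.refl _) (fun h h' => h.trans h')
    (fun h h' => h.antisymm h') (fun _ => Table.iter_ext fun _ _ => sift_ext _ _) h
    ⟨slot k j, slot_lt k j⟩
  have h2 := iter_fixed (r := Table.Ext) (fun _ => Table.Ext.refl _) (fun h h' => h.trans h')
    (fun h h' => h.antisymm h') (fun _ _ => sift_ext _ _) h1 ⟨slot k' j', slot_lt k' j'⟩
  simp only [hu, hu', Option.getD_some] at h2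
  have := sifts_sift hL hT (Γ.mul_mem (hT.mem _ _ hu) (hT.mem _ _ hu'))
  rwa [h2] at this

/-- The measure is the number of filled places, at most `n * n`. Entries are never overwritten, so a
round with the same number of filled places leaves the table as it is. -/
theorem round_iterate_eq (hT : T.Valid L Γ) :
    round L (iter (fun _ : Fin (n * n) => round L) (n * n) T) =
      iter (fun _ : Fin (n * n) => round L) (n * n) T := by
  classical
  refine iter_const_fixed (p := Table.Valid L Γ)
    (μ := fun T => ((Finset.range (n * n)).filter fun e => (T e).isSome).card)
    (fun T hT => hT.round) (fun T _ => ?_) (fun T hT => ?_) hT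
  · exact (Finset.card_filter_le _ _).trans (by simp)
  · by_contra! hcon
    refine hcon.1 (Table.Ext.antisymm (fun e u hu => ?_) (round_ext T))
    have hsub : ((Finset.range (n * n)).filter fun e => (T e).isSome) ⊆
        (Finset.range (n * n)).filter fun e => (round L T e).isSome := by
      intro e
      simp only [Finset.mem_filter, Option.isSome_iff_exists]
      exact fun ⟨he, u, hu⟩ => ⟨he, u, round_ext T e u hu⟩
    have heq := Finset.eq_of_subset_of_card_le hsub hcon.2
    have : e ∈ (Finset.range (n * n)).filter fun e => (round L T e).isSome := by
      simp [hu, hT.round.lt e u hu]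
    rw [← heq, Finset.mem_filter, Option.isSome_iff_exists] at this
    obtain ⟨-, u', hu'⟩ := this
    have := round_ext (L := L) T e u' hu'
    rw [hu] at this
    cases this
    exact hu'

theorem Table.valid_empty : Table.Valid L Γ (fun _ => none) :=
  ⟨by simp, by simp, by simp, by simp⟩

/-! ### Completeness of the table for the generated group -/

section fullTable

variable {m : ℕ} {g : Fin m → Equiv.Perm (Fin n)}

theorem valid_fullTable (hg : ∀ q, g q ∈ Γ) : (fullTable L g).Valid L Γ :=
  Table.Valid.iter (fun _ _ h => h.round) <| Table.Valid.iter (fun q _ h => h.sift (hg q)) <|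
    Table.valid_empty.sift Γ.one_mem

theorem sifts_fullTable (hL : Function.Surjective L) (hg : Subgroup.closure (Set.range g) = Γ)
    {h : Equiv.Perm (Fin n)} (hh : h ∈ Γ) : Sifts L (fullTable L g) 0 h := by
  have hgΓ : ∀ q, g q ∈ Γ := fun q => hg ▸ Subgroup.subset_closure ⟨q, rfl⟩
  have hV₀ : (sift L (fun _ => none) 1).Valid L Γ := Table.valid_empty.sift Γ.one_mem
  set T₁ := iter (fun (q : Fin m) T => sift L T (g q)) m (sift L (fun _ => none) 1) with hT₁
  have hV₁ : T₁.Valid L Γ := Table.Valid.iter (fun q _ h => h.sift (hgΓ q)) hV₀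
  have hE₁ : (sift L (fun _ => none) 1).Ext T₁ := Table.iter_ext (fun _ _ => sift_ext _ _) _
  have hE : T₁.Ext (fullTable L g) := Table.iter_ext (fun _ => round_ext) _
  have hgs : ∀ q, Sifts L (fullTable L g) 0 (g q) := by
    have := iter_induction (f := fun (q : Fin m) T => sift L T (g q))
      (p := fun k T => T.Valid L Γ ∧ ∀ q : Fin m, (q : ℕ) < k → Sifts L T 0 (g q))
      (a := sift L (fun _ => none) 1) ⟨hV₀, by simp⟩ ?_ m le_rfl
    · exact fun q => (this.2 q q.2).mono hE
    · rintro k T ⟨hT, hs⟩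
      refine ⟨hT.sift (hgΓ k), fun q hq => ?_⟩
      rcases Nat.lt_succ_iff_lt_or_eq.1 hq with hq | hq
      · exact (hs q hq).mono (sift_ext _ _)
      · obtain rfl := Fin.ext hq
        exact sifts_sift hL hT (hgΓ q)
  have hV := valid_fullTable (L := L) hgΓ
  refine sifts_of_mem_levelGroup hV (unital_sift_one.mono (hE₁.trans hE))
    (sifts_of_round_eq hL hV (round_iterate_eq hV₁)) n 0 (by simp) h ?_
  rw [← hg] at hh
  refine (Subgroup.closure_le _).2 ?_ hh
  rintro _ ⟨q, rfl⟩
  exact (hgs q).mem_levelGroup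

theorem unital_fullTable : (fullTable L g).Unital L :=
  unital_sift_one.mono
    ((Table.iter_ext (fun _ _ => sift_ext _ _) _).trans (Table.iter_ext (fun _ => round_ext) _))

theorem mem_stab_leaders {k : Fin n} {h : Equiv.Perm (Fin n)} :
    h ∈ stab Γ {i | ∃ j < k, i = L j} ↔ h ∈ Γ ∧ ∀ i < k, h (L i) = L i := by
  simp only [stab, Subgroup.mem_inf, mem_fixingSubgroup_iff, Equiv.Perm.smul_def, Set.mem_ofPred_eq]
  refine and_congr_right fun _ => ⟨fun H i hi => H _ ⟨i, hi, rfl⟩, ?_⟩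
  rintro H _ ⟨i, hi, rfl⟩
  exact H i hi

/-- An orbit point is `h (L k)` for some `h` that fixes the earlier leaders. Such an `h` sifts from
level `k` on, and its first divisor sits at `slot k j`. -/
theorem exists_of_mem_leaderOrbit (hL : Function.Surjective L)
    (hg : Subgroup.closure (Set.range g) = Γ) {k j : Fin n} (hj : j ∈ leaderOrbit Γ L k) :
    ∃ u, fullTable L g (slot k j) = some u := by
  obtain ⟨⟨h, hh⟩, rfl⟩ := hj
  obtain ⟨hΓ, hfix⟩ := mem_stab_leaders.1 hh
  have hs := (sifts_fullTable hL hg hΓ).of_fix unital_fullTable k k.2.le fun i hi => hfix i hi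
  generalize hk : (k : ℕ) = k' at hs
  cases hs with
  | one => omega
  | step k₀ _ u hu _ =>
    obtain rfl := Fin.ext hk
    exact ⟨u, hu⟩

end fullTable

/-! ### Moving a solution into the cone of the SST cuts -/

/-- If the table has an element that raises the value at the `k`-th leader to that at `j`, then
apply it. -/
def raiseStep (L : Fin n → Fin n) (T : Table n) (k j : Fin n) (x : Fin n → ℕ) : Fin n → ℕ :=
  match T (slot k j) with
  | some u => if x (L k) < x j then x ∘ u else x
  | none => x

/-- Raise the values at the leaders, one after the other. -/
def raise (L : Fin n → Fin n) (T : Table n) (x : Fin n → ℕ) : Fin n → ℕ :=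
  iter (fun k => iter (fun j => raiseStep L T k j) n) n x

theorem smul_mem_leaderOrbit {k j f : Fin n} {u : Equiv.Perm (Fin n)} (hu : u ∈ Γ)
    (hfix : ∀ i < k, u (L i) = L i) (hjk : j ≤ k) (hf : f ∈ leaderOrbit Γ L j) :
    u f ∈ leaderOrbit Γ L j :=
  MulAction.mem_orbit_of_mem_orbit (⟨u, mem_stab_leaders.2
    ⟨hu, fun i hi => hfix i (hi.trans_le hjk)⟩⟩ : stab Γ {i | ∃ i' < j, i = L i'}) hf

theorem raise_spec (hT : T.Valid L Γ)
    (horb : ∀ k, ∀ j ∈ leaderOrbit Γ L k, ∃ u, T (slot k j) = some u)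
    (x : Fin n → ℕ) (hx : ∀ i, x i ≤ 1) :
    (∃ γ ∈ Γ, raise L T x = x ∘ γ) ∧
      ∀ k, ∀ f ∈ leaderOrbit Γ L k, raise L T x f ≤ raise L T x (L k) := by
  have key := iter_induction (f := fun k => iter (fun j => raiseStep L T k j) n) (a := x)
    (p := fun k y => (∃ γ ∈ Γ, y = x ∘ γ) ∧
      ∀ k' : Fin n, (k' : ℕ) < k → ∀ f ∈ leaderOrbit Γ L k', y f ≤ y (L k'))
    ⟨⟨1, Γ.one_mem, rfl⟩, by simp⟩ ?_ n le_rfl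
  · exact ⟨key.1, fun k => key.2 k k.2⟩
  rintro k y hy
  -- Within level `k` the inner invariant adds that no table point `j'` treated so far exceeds the
  -- leader; at the end this gives the cuts of level `k`.
  have key' := iter_induction (f := fun j => raiseStep L T k j) (a := y)
    (p := fun j y => ((∃ γ ∈ Γ, y = x ∘ γ) ∧
      ∀ k' : Fin n, (k' : ℕ) < k → ∀ f ∈ leaderOrbit Γ L k', y f ≤ y (L k')) ∧
      ∀ j' : Fin n, (j' : ℕ) < j → (∃ u, T (slot k j') = some u) → y j' ≤ y (L k))
    ⟨hy, by simp⟩ ?_ n le_rfl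
  · refine ⟨key'.1.1, fun k' hk' f hf => ?_⟩
    rcases Nat.lt_succ_iff_lt_or_eq.1 hk' with hk' | hk'
    · exact key'.1.2 k' hk' f hf
    · obtain rfl := Fin.ext hk'
      exact key'.2 f f.2 (horb _ f hf)
  rintro j y ⟨⟨⟨γ, hγ, rfl⟩, hcut⟩, hmax⟩
  have hsame : (∀ u, T (slot k j) = some u → (x ∘ γ) j ≤ (x ∘ γ) (L k)) →
      ((∃ γ' ∈ Γ, x ∘ γ = x ∘ γ') ∧ ∀ k' : Fin n, (k' : ℕ) < k → ∀ f ∈ leaderOrbit Γ L k',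
        (x ∘ γ) f ≤ (x ∘ γ) (L k')) ∧ ∀ j' : Fin n, (j' : ℕ) < j + 1 →
          (∃ u, T (slot k j') = some u) → (x ∘ γ) j' ≤ (x ∘ γ) (L k) := by
    refine fun hj => ⟨⟨⟨γ, hγ, rfl⟩, hcut⟩, fun j' hj' h => ?_⟩
    rcases Nat.lt_succ_iff_lt_or_eq.1 hj' with hj' | hj'
    · exact hmax j' hj' h
    · obtain rfl := Fin.ext hj'
      exact hj _ h.choose_spec
  rcases hTu : T (slot k j) with _ | u
  · have : raiseStep L T k j (x ∘ γ) = x ∘ γ := by simp [raiseStep, hTu]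
    rw [this]
    exact hsame (by simp [hTu])
  · by_cases hlt : (x ∘ γ) (L k) < (x ∘ γ) j
    · have : raiseStep L T k j (x ∘ γ) = x ∘ ⇑(γ * u) := by
        simp only [raiseStep, hTu, if_pos hlt]
        rfl
      rw [this]
      refine ⟨⟨⟨γ * u, Γ.mul_mem hγ (hT.mem _ _ hTu), rfl⟩, fun k' hk' f hf => ?_⟩,
        fun j' _ _ => ?_⟩
      · have := hcut k' hk' (u f)
          (smul_mem_leaderOrbit (hT.mem _ _ hTu) (hT.fix _ _ _ hTu) (Fin.le_def.2 hk'.le) hf)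
        simpa [hT.fix _ _ _ hTu k' hk'] using this
      · have h1 : (x ∘ ⇑(γ * u)) (L k) = (x ∘ γ) j := by simp [hT.map _ _ _ hTu]
        rw [h1]
        -- Binary values enter here: the leader now has a value exceeding a natural number, hence at
        -- least 1, and no entry exceeds 1.
        exact (hx _).trans (by omega)
    · have : raiseStep L T k j (x ∘ γ) = x ∘ γ := by
        simp only [raiseStep, hTu, if_neg hlt]
      rw [this]
      exact hsame fun _ _ => not_lt.1 hlt


/-! ### The programs

Registers: `0` total length of the generators, `1` number `n` of points, `2` the number one,
`3` loop guard. Arrays: `0` generators, `1` leaders, `2` current permutation `h`, `3` table of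
representatives, `4` table of their inverses, `5` marks for the places in the table that are in
use, `6` solution, `7` scratch. -/

namespace Prog

/-- `z := x * y` -/
def mul (z x y : ℕ) : Prog := .seq (.const z 0) (.forLoop 4 x 2 (.add z z y))

/-- `h := 1` -/
def setOne : Prog := .forLoop 5 1 2 (.store 2 5 5)

/-- `h := u * h` for the permutation `u` at position `b` of array `a` -/
def apply (a b : ℕ) : Prog :=
  .forLoop 5 1 2 (.seq (.load 6 2 5) (.seq (.add 6 6 b) (.seq (.load 6 a 6) (.store 2 5 6))))

/-- Write `h` into the table at position `11`. -/
def insert : Prog :=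
  .forLoop 5 1 2 (.seq (.load 6 2 5) (.seq (.add 7 11 5) (.seq (.store 3 7 6)
    (.seq (.add 7 11 6) (.store 4 7 5)))))

/-- Compute the index (register `10`) and the mark (register `12`) of the place for the level in
register `8` and the point in register `9`. -/
def findSlot : Prog :=
  .seq (.mul 10 8 1) (.seq (.add 10 10 9) (.load 12 5 10))

/-- After the conditional the place is filled in either case, so one multiplication by the stored
inverse serves both; a freshly inserted `h` turns into 1. -/
def siftStep : Prog :=
  .seq (.load 9 1 8) (.seq (.load 9 2 9) (.seq findSlot (.seq (.mul 11 10 1)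
    (.seq (.cond 12 (.const 12 0) (.seq (.store 5 10 2) insert)) (.apply 4 11)))))

def sift : Prog := .forLoop 8 1 2 siftStep

/-- `h := u * h` for the table entry `u` at the place in register `e`, if there is one -/
def applySlot (e : ℕ) : Prog :=
  .seq (.load 12 5 e) (.cond 12 (.seq (.mul 11 e 1) (.apply 3 11)) (.const 12 0))

/-- Entries multiply from the left, so the right factor, counted by register `14`, comes first. -/
def siftPair : Prog := .seq setOne (.seq (applySlot 14) (.seq (applySlot 13) sift))

def round : Prog := .forLoop 13 15 2 (.forLoop 14 15 2 siftPair)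

/-- The counter advances by `n`, so it is directly the offset of the next generator in the input
array. -/
def siftGenerators : Prog := .forLoop 17 0 1 (.seq setOne (.seq (.apply 0 17) sift))

def fullTable : Prog :=
  .seq setOne (.seq sift (.seq siftGenerators (.seq (.mul 15 1 1) (.forLoop 16 15 2 round))))

/-- Permute the solution by the table entry at position `11`. -/
def permute : Prog :=
  .seq (.forLoop 5 1 2 (.seq (.add 6 11 5) (.seq (.load 6 3 6) (.seq (.load 6 6 6)
    (.store 7 5 6)))))
  (.forLoop 5 1 2 (.seq (.load 6 7 5) (.store 6 5 6)))

def raiseStep : Prog :=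
  .seq findSlot (.cond 12
    (.seq (.load 6 1 8) (.seq (.load 6 6 6) (.seq (.load 7 6 9) (.seq (.sub 7 7 6)
      (.cond 7 (.seq (.mul 11 10 1) permute) (.const 12 0))))))
    (.const 12 0))

def raise : Prog := .forLoop 8 1 2 (.forLoop 9 1 2 raiseStep)

/-- Copy the solution from the array `out`. -/
def copySolution (out : ℕ) : Prog := .forLoop 5 1 2 (.seq (.load 6 out 5) (.store 6 5 6))

/-- Move the solution in the array `out` into the cone of the SST cuts. -/
def moveSolution (out : ℕ) : Prog :=
  .seq (.const 2 1) (.seq (copySolution out) (.seq fullTable raise))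

end Prog

/-- The table of `h` is stored in the array `A` from position `o` on. -/
def IsPermAt (A : ℕ → ℕ) (o : ℕ) (h : Equiv.Perm (Fin n)) : Prop := ∀ i : Fin n, A (o + i) = h i

/-- The table `T` is stored in memory. -/
structure IsTable (A : ℕ → ℕ → ℕ) (T : Table n) : Prop where
  unused : ∀ e, T e = none → A 5 e = 0
  used : ∀ e u, T e = some u → A 5 e = 1
  perm : ∀ e u, T e = some u → IsPermAt (A 3) (e * n) u
  inv : ∀ e u, T e = some u → IsPermAt (A 4) (e * n) u⁻¹

/-- The constants that the programs use. -/
structure Consts (L : Fin n → Fin n) (s : State) : Prop where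
  card : s.reg 1 = n
  one : s.reg 2 = 1
  leader : ∀ k : Fin n, s.arr 1 k = L k

theorem Consts.agree {L : Fin n → Fin n} {s s' : State} (h : Consts L s) {p : Prog}
    (hA : Agree p s s') (hp : 1 ∉ p.wregs ∧ 2 ∉ p.wregs ∧ 1 ∉ p.warrs) : Consts L s' :=
  ⟨(hA.reg 1 hp.1).trans h.card, (hA.reg 2 hp.2.1).trans h.one, by
    rw [hA.arr 1 hp.2.2]; exact h.leader⟩

theorem IsTable.congr {A A' : ℕ → ℕ → ℕ} {T : Table n} (h : IsTable A T) (h3 : A' 3 = A 3)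
    (h4 : A' 4 = A 4) (h5 : A' 5 = A 5) : IsTable A' T := by
  refine ⟨?_, ?_, ?_, ?_⟩
  · rw [h5]; exact h.unused
  · rw [h5]; exact h.used
  · rw [h3]; exact h.perm
  · rw [h4]; exact h.inv

theorem IsTable.agree {s s' : State} {T : Table n} (h : IsTable s.arr T) {p : Prog}
    (hA : Agree p s s') (hp : 3 ∉ p.warrs ∧ 4 ∉ p.warrs ∧ 5 ∉ p.warrs) : IsTable s'.arr T :=
  h.congr (hA.arr 3 hp.1) (hA.arr 4 hp.2.1) (hA.arr 5 hp.2.2)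

/-! ### Correctness and step counts of the programs -/

variable {s : State} {h u : Equiv.Perm (Fin n)}

theorem Wp.mul {z x y : ℕ} (hz : z ≠ 2 ∧ z ≠ 3 ∧ z ≠ 4 ∧ z ≠ x ∧ z ≠ y)
    (hx : x ≠ 3 ∧ x ≠ 4) (hy : y ≠ 3 ∧ y ≠ 4) (h1 : s.reg 2 = 1) :
    Wp (.mul z x y) (s.reg x * 4 + 4) (fun s' => s'.reg z = s.reg x * s.reg y) s := by
  obtain ⟨hz2, hz3, hz4, hzx, hzy⟩ := hz
  refine (Wp.seq (Wp.const ?_)).le (T₁ := 1 + (s.reg x * (1 + 3) + 3)) (by omega)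
  refine Wp.forLoop_of_stable (v := 1) (Inv := fun k s' => s'.reg z = k * s.reg y) (by decide)
    ?_ ?_ ?_ one_pos ?_ ?_ ?_
  · simp [Prog.forLoop, Prog.wregs]
    omega
  · simp [Ne.symm hzx]
  · simp [Ne.symm hz2, h1]
  · rintro k s w r (rfl | rfl) <;> simp [hz3, hz4]
  · simp
  · intro k hk s₁ hA hk4 hI
    have : s₁.reg y = s.reg y := by
      rw [hA.reg y (by simp [Prog.forLoop, Prog.wregs]; omega)]
      simp [Ne.symm hzy]
    exact Wp.add (by simp [hI, this]; ring)

/-- A loop over `0, …, n - 1` with counter in register `i`. -/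
theorem Wp.forLoop_card {i B : ℕ} {body : Prog} {Inv : ℕ → (ℕ → ℕ → ℕ) → Prop}
    (hc : Consts L s)
    (hw : i ≠ 3 ∧ i ∉ body.wregs ∧ 1 ∉ (Prog.forLoop i 1 2 body).wregs ∧
      2 ∉ (Prog.forLoop i 1 2 body).wregs) (h0 : Inv 0 s.arr)
    (hb : ∀ k : Fin n, ∀ s₁, Agree (.forLoop i 1 2 body) s s₁ → s₁.reg i = k →
      Inv k s₁.arr → Wp body B (fun s₂ => Inv (k + 1) s₂.arr) s₁) :
    Wp (.forLoop i 1 2 body) (n * (B + 3) + 3) (fun s' => Inv n s'.arr) s :=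
  Wp.forLoop (v := 1) hw.1 hw.2 (by simp [hc.card]) hc.one one_pos h0
    fun k hk s₁ hA hki => hb ⟨k, hk⟩ s₁ hA (by simpa using hki)

theorem Wp.setOne (hc : Consts L s) :
    Wp .setOne (n * 4 + 3) (fun s' => IsPermAt (s'.arr 2) 0 (1 : Equiv.Perm (Fin n))) s := by
  refine (Wp.forLoop_card (B := 1) hc (by decide)
    (Inv := fun k A => ∀ i : Fin n, (i : ℕ) < k → A 2 i = i) (by simp) ?_).mono le_rfl
    fun s' h i => by simpa using h i i.2
  intro k s₁ hA hk hI
  refine Wp.store fun i hi => ?_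
  simp only [State.setArr_arr, if_true, Function.update_apply, hk]
  split
  · exact Eq.symm (by assumption)
  · exact hI i (by omega)

/-- Left multiplication works in place: cell `k` is read only in the pass that overwrites it. -/
theorem Wp.apply {a b : ℕ} (hc : Consts L s) (hb : b ≠ 3 ∧ b ≠ 5 ∧ b ≠ 6) (ha : a ≠ 2)
    (hh : IsPermAt (s.arr 2) 0 h) (hu : IsPermAt (s.arr a) (s.reg b) u) :
    Wp (.apply a b) (n * 7 + 3) (fun s' => IsPermAt (s'.arr 2) 0 (u * h)) s := by
  refine (Wp.forLoop_card (B := 1 + (1 + (1 + 1))) hc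
    (by simp [Prog.forLoop, Prog.wregs])
    (Inv := fun k A => ∀ i : Fin n, A 2 i = if (i : ℕ) < k then (u (h i) : ℕ) else h i)
    (by simpa [IsPermAt] using hh) ?_).mono le_rfl fun s' h i => by simpa using h i
  intro k s₁ hA hk hI
  have h2 : s₁.reg b = s.reg b := hA.reg b (by simp [Prog.forLoop, Prog.wregs]; omega)
  have h3 : s₁.arr a = s.arr a := hA.arr a (by simpa [Prog.forLoop, Prog.warrs] using ha)
  refine Wp.seq (Wp.load (Wp.seq (Wp.add (Wp.seq (Wp.load (Wp.store fun i => ?_))))))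
  have hk2 := hI k
  have huk := hu (h k)
  simp only [lt_irrefl, if_false] at hk2
  rw [add_comm] at huk
  simp only [State.setReg_reg, State.setReg_arr, State.setArr_arr, hk, hk2, h2, h3, huk, hb.2.2,
    Function.update_apply, if_true, if_false, Fin.val_inj, show (5 : ℕ) ≠ 6 by decide]
  split
  · subst_vars; simp
  · rename_i hik
    have : (i : ℕ) ≠ k := fun e => hik (Fin.ext e)
    rw [hI i]
    exact if_congr (by omega) rfl rfl

theorem Consts.setReg (hc : Consts L s) {x : ℕ} (hx : x ≠ 1 ∧ x ≠ 2) (v : ℕ) :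
    Consts L (s.setReg x v) :=
  ⟨by simp [hx.1.symm, hc.card], by simp [hx.2.symm, hc.one], hc.leader⟩

theorem Wp.insert (hc : Consts L s) (hh : IsPermAt (s.arr 2) 0 h) :
    Wp .insert (n * 8 + 3) (fun s' => IsPermAt (s'.arr 3) (s.reg 11) h ∧
      IsPermAt (s'.arr 4) (s.reg 11) h⁻¹ ∧ ∀ p, (∀ i : Fin n, p ≠ s.reg 11 + i) →
        s'.arr 3 p = s.arr 3 p ∧ s'.arr 4 p = s.arr 4 p) s := by
  refine (Wp.forLoop_card (B := 1 + (1 + (1 + (1 + 1)))) hc (by decide)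
    (Inv := fun k A => (∀ i : Fin n, (i : ℕ) < k → A 3 (s.reg 11 + i) = h i ∧
      A 4 (s.reg 11 + h i) = i) ∧ ∀ p, (∀ i : Fin n, p ≠ s.reg 11 + i) →
        A 3 p = s.arr 3 p ∧ A 4 p = s.arr 4 p) (by simp) ?_).mono le_rfl ?_
  · intro k s₁ hA hk hI
    have h11 : s₁.reg 11 = s.reg 11 := hA.reg 11 (by decide)
    have h2 : s₁.arr 2 = s.arr 2 := hA.arr 2 (by decide)
    have hhk := hh k
    rw [zero_add] at hhk
    refine Wp.seq (Wp.load (Wp.seq (Wp.add (Wp.seq (Wp.store (Wp.seq (Wp.add (Wp.store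
      ⟨fun i hi => ?_, fun p hp => ?_⟩))))))))
    · rcases Nat.lt_succ_iff_lt_or_eq.1 hi with hi' | hi'
      · have h1 : (i : ℕ) ≠ k := hi'.ne
        -- Injectivity of `h` protects the cells of the inverse written earlier.
        have h3 : (h i : ℕ) ≠ h k := fun e => h1 (congrArg _ (h.injective (Fin.ext e)))
        simpa [hk, h11, h2, hhk, Function.update_apply, h1, h3] using hI.1 i hi'
      · obtain rfl := Fin.ext hi'
        simp [hk, h11, h2, hhk]
    · have h1 := hp k
      have h3 := hp (h k)
      simpa [hk, h11, h2, hhk, Function.update_apply, h1, h3] using hI.2 p hp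
  · rintro s' ⟨h1, h2⟩
    refine ⟨fun i => (h1 i i.2).1, fun i => ?_, h2⟩
    simpa using (h1 (h⁻¹ i) (h⁻¹ i).2).2

theorem Wp.findSlot (hc : Consts L s) {k j : Fin n} (hk : s.reg 8 = k) (hj : s.reg 9 = j) :
    Wp .findSlot (n * 4 + 6) (fun s' => s'.reg 10 = slot k j ∧ s'.reg 12 = s.arr 5 (slot k j))
      s := by
  refine Wp.seq (T₁ := n * 4 + 4) (T₂ := 1 + 1)
    (((Wp.mul (by decide) (by decide) (by decide) hc.one).agree fun s₁ hA h => ?_).le ?_)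
  · refine Wp.seq (Wp.add (Wp.load ?_))
    have h9 : s₁.reg 9 = j := (hA.reg 9 (by decide)).trans hj
    have h5 : s₁.arr 5 = s.arr 5 := hA.arr 5 (by decide)
    simp [h, h9, h5, hk, hc.card, slot]
  · rw [hk]; have := k.2; omega

theorem mul_add_ne {e e' : ℕ} (he : e' ≠ e) (i i' : Fin n) : e' * n + i ≠ e * n + i' := by
  intro h
  have hn : 0 < n := i.pos
  have : (e' * n + i) / n = (e * n + i') / n := by rw [h]
  rw [mul_comm, Nat.mul_add_div hn, Nat.div_eq_of_lt i.2, mul_comm, Nat.mul_add_div hn,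
    Nat.div_eq_of_lt i'.2] at this
  omega

/-- Different places occupy disjoint blocks of length `n`, so writing one block leaves the other
entries intact. -/
theorem IsTable.update {A A' : ℕ → ℕ → ℕ} (hT : IsTable A T) {e : ℕ}
    (h5 : A' 5 = Function.update (A 5) e 1) (h3 : IsPermAt (A' 3) (e * n) h)
    (h4 : IsPermAt (A' 4) (e * n) h⁻¹)
    (hne : ∀ p, (∀ i : Fin n, p ≠ e * n + i) → A' 3 p = A 3 p ∧ A' 4 p = A 4 p) :
    IsTable A' (Function.update T e (some h)) := by
  refine ⟨fun e' he' => ?_, fun e' u he' => ?_, fun e' u he' => ?_, fun e' u he' => ?_⟩ <;>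
  rw [Function.update_apply] at he' <;> split at he'
  · cases he'
  · rename_i hn
    rw [h5, Function.update_of_ne hn, hT.unused _ he']
  · rename_i heq
    rw [h5, heq, Function.update_self]
  · rename_i hn
    rw [h5, Function.update_of_ne hn, hT.used _ _ he']
  · rename_i heq
    cases he'; rw [heq]; exact h3
  · rename_i hn
    exact fun i => ((hne _ (mul_add_ne hn i)).1).trans (hT.perm _ _ he' i)
  · rename_i heq
    cases he'; rw [heq]; exact h4
  · rename_i hn
    exact fun i => ((hne _ (mul_add_ne hn i)).2).trans (hT.inv _ _ he' i)

/-- The step count of one level of sifting. -/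
def siftStepTime (n : ℕ) : ℕ :=
  1 + (1 + (n * 4 + 6 + (n * n * 4 + 4 + ((1 + (1 + (n * 8 + 3)) + 1) + (n * 7 + 3)))))

/-- The table `a.1` and the permutation `a.2` are stored in memory. -/
def IsSiftState (A : ℕ → ℕ → ℕ) (a : Table n × Equiv.Perm (Fin n)) : Prop :=
  IsTable A a.1 ∧ IsPermAt (A 2) 0 a.2

theorem Wp.siftStep (hc : Consts L s) {k : Fin n} (hk : s.reg 8 = k)
    {a : Table n × Equiv.Perm (Fin n)} (ha : IsSiftState s.arr a) :
    Wp .siftStep (siftStepTime n) (fun s' => IsSiftState s'.arr (SST.siftStep L k a)) s := by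
  obtain ⟨T, h⟩ := a
  obtain ⟨hT, hh⟩ := ha
  dsimp only at hT hh
  have hhL : s.arr 2 (s.arr 1 k) = h (L k) := by rw [hc.leader]; simpa using hh (L k)
  refine Wp.seq (Wp.load (Wp.seq (Wp.load (Wp.seq ((Wp.findSlot (k := k) (j := h (L k))
    ((hc.setReg (by decide) _).setReg (by decide) _) (by simp [hk]) (by simp [hk, hhL])).agree
      fun s₁ hA₁ hs₁ => ?_)))))
  have hc₁ := ((hc.setReg (x := 9) (by decide) _).setReg (x := 9) (by decide) _).agree hA₁
    (by decide)
  have hA₁' := fun a ha => hA₁.arr a ha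
  simp only [State.setReg_arr] at hA₁' hs₁
  set e := slot k (h (L k)) with he
  have hT₁ : IsTable s₁.arr T :=
    hT.congr (hA₁' 3 (by decide)) (hA₁' 4 (by decide)) (hA₁' 5 (by decide))
  have hh₁ : IsPermAt (s₁.arr 2) 0 h := by rw [hA₁' 2 (by decide)]; exact hh
  have hlt : e < n * n := slot_lt _ _
  refine Wp.seq (((Wp.mul (by decide) (by decide) (by decide) hc₁.one).agree
    fun s₂ hA₂ hs₂ => ?_).le (by rw [hs₁.1]; omega))
  have hc₂ := hc₁.agree hA₂ (by decide)
  have hT₂ := hT₁.agree hA₂ (by decide)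
  have hh₂ : IsPermAt (s₂.arr 2) 0 h := by rw [hA₂.arr 2 (by decide)]; exact hh₁
  have h12 : s₂.reg 12 = s.arr 5 e := (hA₂.reg 12 (by decide)).trans hs₁.2
  have h10 : s₂.reg 10 = e := (hA₂.reg 10 (by decide)).trans hs₁.1
  rw [hs₁.1, hc₁.card] at hs₂
  refine Wp.seq (Wp.cond (fun hne => Wp.const ?_) fun h0 => Wp.seq (Wp.store ?_))
  · rw [h12] at hne
    cases hTe : T e with
    | none => exact absurd (hT.unused _ hTe) hne
    | some u =>
      refine (Wp.apply (u := u⁻¹) (hc₂.setReg (by decide) _) (by decide) (by decide) hh₂ ?_).agree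
        fun s₃ hA₃ hs₃ => ?_
      · simpa [hs₂] using hT₂.inv _ _ hTe
      · simp only [SST.siftStep, ← he, hTe]
        exact ⟨hT₂.congr (hA₃.arr 3 (by decide)) (hA₃.arr 4 (by decide)) (hA₃.arr 5 (by decide)),
          hs₃⟩
  · rw [h12] at h0
    cases hTe : T e with
    | some u => rw [hT.used _ _ hTe] at h0; cases h0
    | none =>
      have hc₃ : Consts L (s₂.setArr 5 (s₂.reg 10) (s₂.reg 2)) :=
        ⟨hc₂.card, hc₂.one, hc₂.leader⟩
      refine (Wp.insert (h := h) hc₃ (by simpa using hh₂)).agree fun s₄ hA₄ hs₄ => ?_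
      have hc₄ := hc₃.agree hA₄ (by decide)
      have h11 : s₄.reg 11 = e * n := by rw [hA₄.reg 11 (by decide)]; exact hs₂
      simp only [State.setArr_reg, hs₂, State.setArr_arr, if_false,
        show ((3 : ℕ) = 5) = False by decide, show ((4 : ℕ) = 5) = False by decide] at hs₄
      have h5 : s₄.arr 5 = Function.update (s₂.arr 5) e 1 := by
        rw [hA₄.arr 5 (by decide)]; simp [h10, hc₂.one]
      have hh₄ : IsPermAt (s₄.arr 2) 0 h := by
        rw [hA₄.arr 2 (by decide)]; simpa using hh₂
      refine (Wp.apply (u := h⁻¹) hc₄ (by decide) (by decide) hh₄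
        (by rw [h11]; exact hs₄.2.1)).agree fun s₅ hA₅ hs₅ => ?_
      simp only [SST.siftStep, ← he, hTe]
      rw [inv_mul_cancel] at hs₅
      exact ⟨(hT₂.update h5 hs₄.1 hs₄.2.1 hs₄.2.2).agree hA₅ (by decide), hs₅⟩

/-- The step count of sifting. -/
def siftTime (n : ℕ) : ℕ := n * (siftStepTime n + 3) + 3

theorem Wp.sift (hc : Consts L s) (hT : IsTable s.arr T) (hh : IsPermAt (s.arr 2) 0 h) :
    Wp .sift (siftTime n) (fun s' => IsTable s'.arr (SST.sift L T h)) s := by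
  refine (Wp.forLoop_card hc (by decide)
    (Inv := fun k A => IsSiftState A (iter (SST.siftStep L) k (T, h))) ⟨hT, hh⟩
    fun k s₁ hA hk hI => ?_).mono le_rfl fun s' h => h.1
  rw [iter_succ k.2]
  exact Wp.siftStep (hc.agree hA (by decide)) hk hI

theorem Wp.applySlot {e : ℕ} {r : ℕ} (hr : r ≠ 2 ∧ r ≠ 3 ∧ r ≠ 4 ∧ r ≠ 11 ∧ r ≠ 12)
    (he : e < n * n) (hc : Consts L s) (hT : IsTable s.arr T)
    (hh : IsPermAt (s.arr 2) 0 h) (hre : s.reg r = e) :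
    Wp (.applySlot r) (1 + ((n * n * 4 + 4 + (n * 7 + 3)) + 1 + 1))
      (fun s' => IsPermAt (s'.arr 2) 0 ((T e).getD 1 * h)) s := by
  refine Wp.seq (Wp.load (Wp.cond (fun hne => ?_) fun h0 => Wp.const ?_))
  · simp only [State.setReg_reg, if_true, hre] at hne
    cases hTe : T e with
    | none => exact absurd (hT.unused _ hTe) hne
    | some u =>
      have hc₁ := hc.setReg (x := 12) (by decide) (s.arr 5 (s.reg r))
      refine Wp.seq (((Wp.mul ⟨by decide, by decide, by decide, hr.2.2.2.1.symm, by decide⟩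
        ⟨hr.2.1, hr.2.2.1⟩ (by decide) hc₁.one).agree fun s₂ hA₂ hs₂ => ?_).le ?_)
      · have hA₂' : Agree (.mul 11 0 1) (s.setReg 12 (s.arr 5 (s.reg r))) s₂ := ⟨hA₂.reg, hA₂.arr⟩
        simp only [State.setReg_reg, hr.2.2.2.2, if_false, hre, hc.card,
          show (1 : ℕ) ≠ 12 by decide] at hs₂
        refine Wp.apply (u := u) (hc₁.agree hA₂' (by decide)) (by decide) (by decide) ?_ ?_
        · rw [hA₂'.arr 2 (by decide)]; exact hh
        · rw [hs₂, hA₂'.arr 3 (by decide)]; exact hT.perm _ _ hTe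
      · simp only [State.setReg_reg, hr.2.2.2.2, if_false, hre]
        omega
  · simp only [State.setReg_reg, if_true, hre] at h0
    cases hTe : T e with
    | some u => rw [hT.used _ _ hTe] at h0; cases h0
    | none => simpa using hh

/-- The step count of sifting the product of two table entries. -/
def siftPairTime (n : ℕ) : ℕ :=
  n * 4 + 3 + (1 + ((n * n * 4 + 4 + (n * 7 + 3)) + 1 + 1) +
    (1 + ((n * n * 4 + 4 + (n * 7 + 3)) + 1 + 1) + siftTime n))

theorem Wp.siftPair (hc : Consts L s) (hT : IsTable s.arr T) {e e' : Fin (n * n)}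
    (he : s.reg 13 = e) (he' : s.reg 14 = e') :
    Wp .siftPair (siftPairTime n)
      (fun s' => IsTable s'.arr (SST.sift L T ((T e).getD 1 * (T e').getD 1))) s := by
  refine Wp.seq ((Wp.setOne hc).agree fun s₁ hA₁ hs₁ => ?_)
  have hc₁ := hc.agree hA₁ (by decide)
  have hT₁ := hT.agree hA₁ (by decide)
  refine Wp.seq ((Wp.applySlot (by decide) e'.2 hc₁ hT₁ hs₁
    ((hA₁.reg 14 (by decide)).trans he')).agree fun s₂ hA₂ hs₂ => ?_)
  have hc₂ := hc₁.agree hA₂ (by decide)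
  have hT₂ := hT₁.agree hA₂ (by decide)
  refine Wp.seq ((Wp.applySlot (by decide) e.2 hc₂ hT₂ hs₂
    ((hA₂.reg 13 (by decide)).trans ((hA₁.reg 13 (by decide)).trans he))).agree
    fun s₃ hA₃ hs₃ => ?_)
  rw [mul_one] at hs₃
  exact Wp.sift (hc₂.agree hA₃ (by decide)) (hT₂.agree hA₃ (by decide)) hs₃

/-- The step count of a round of sifting. -/
def roundTime (n : ℕ) : ℕ := n * n * (n * n * (siftPairTime n + 3) + 3 + 3) + 3

/-- A loop over the places in the table. -/
theorem Wp.forLoop_slots {i B : ℕ} {body : Prog} {f : Fin (n * n) → Table n → Table n}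
    (hc : Consts L s) (h15 : s.reg 15 = n * n)
    (hw : i ≠ 3 ∧ i ∉ body.wregs ∧ 15 ∉ (Prog.forLoop i 15 2 body).wregs ∧
      2 ∉ (Prog.forLoop i 15 2 body).wregs) (hT : IsTable s.arr T)
    (hb : ∀ k : Fin (n * n), ∀ s₁ T, Agree (.forLoop i 15 2 body) s s₁ → s₁.reg i = k →
      IsTable s₁.arr T → Wp body B (fun s₂ => IsTable s₂.arr (f k T)) s₁) :
    Wp (.forLoop i 15 2 body) (n * n * (B + 3) + 3)
      (fun s' => IsTable s'.arr (iter f (n * n) T)) s := by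
  refine Wp.forLoop (v := 1) (Inv := fun k A => IsTable A (iter f k T)) hw.1 hw.2 (by simp [h15])
    hc.one one_pos hT fun k hk s₁ hA hki hI => ?_
  rw [iter_succ hk]
  exact hb ⟨k, hk⟩ s₁ _ hA (by simpa using hki) hI

theorem Wp.round (hc : Consts L s) (h15 : s.reg 15 = n * n) (hT : IsTable s.arr T) :
    Wp .round (roundTime n) (fun s' => IsTable s'.arr (SST.round L T)) s :=
  Wp.forLoop_slots hc h15 (by decide) hT fun _ _ _ hA₁ hk₁ hT₁ =>
    Wp.forLoop_slots (hc.agree hA₁ (by decide)) ((hA₁.reg 15 (by decide)).trans h15) (by decide) hT₁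
      fun _ _ _ hA₂ hk₂ hT₂ => Wp.siftPair ((hc.agree hA₁ (by decide)).agree hA₂ (by decide)) hT₂
        ((hA₂.reg 13 (by decide)).trans hk₁) hk₂

/-- The `m` permutations `g` are stored in the array `0`. -/
structure IsGenerators {m : ℕ} (g : Fin m → Equiv.Perm (Fin n)) (s : State) : Prop where
  length : s.reg 0 = m * n
  perm : ∀ q : Fin m, IsPermAt (s.arr 0) (q * n) (g q)

theorem IsGenerators.agree {m : ℕ} {g : Fin m → Equiv.Perm (Fin n)} {s s' : State}
    (h : IsGenerators g s) {p : Prog} (hA : Agree p s s') (hp : 0 ∉ p.wregs ∧ 0 ∉ p.warrs) :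
    IsGenerators g s' :=
  ⟨(hA.reg 0 hp.1).trans h.length, by rw [hA.arr 0 hp.2]; exact h.perm⟩

/-- The step count of sifting the generators. -/
def siftGeneratorsTime (n m : ℕ) : ℕ := m * (n * 4 + 3 + (n * 7 + 3 + siftTime n) + 3) + 3

theorem Wp.siftGenerators {m : ℕ} {g : Fin m → Equiv.Perm (Fin n)} (hn : 0 < n) (hc : Consts L s)
    (hg : IsGenerators g s) (hT : IsTable s.arr T) :
    Wp .siftGenerators (siftGeneratorsTime n m)
      (fun s' => IsTable s'.arr (iter (fun (q : Fin m) T => SST.sift L T (g q)) m T)) s := by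
  refine Wp.forLoop (v := n)
    (Inv := fun k A => IsTable A (iter (fun (q : Fin m) T => SST.sift L T (g q)) k T))
    (by decide) (by decide) hg.length hc.card hn hT fun k hk s₁ hA hki hI => ?_
  have hc₁ := hc.agree hA (by decide)
  have hg₁ := hg.agree hA (by decide)
  rw [iter_succ hk]
  refine Wp.seq ((Wp.setOne hc₁).agree fun s₂ hA₂ hs₂ => ?_)
  have hc₂ := hc₁.agree hA₂ (by decide)
  have hg₂ := hg₁.agree hA₂ (by decide)
  refine Wp.seq ((Wp.apply (u := g ⟨k, hk⟩) hc₂ (by decide) (by decide) hs₂ ?_).agree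
    fun s₃ hA₃ hs₃ => ?_)
  · rw [hA₂.reg 17 (by decide), hki]
    exact hg₂.perm ⟨k, hk⟩
  · rw [mul_one] at hs₃
    exact Wp.sift (hc₂.agree hA₃ (by decide))
      ((hI.agree hA₂ (by decide)).agree hA₃ (by decide)) hs₃

/-- The step count of building the complete table. -/
def fullTableTime (n m : ℕ) : ℕ :=
  n * 4 + 3 + (siftTime n + (siftGeneratorsTime n m + (n * 4 + 4 +
    (n * n * (roundTime n + 3) + 3))))

theorem Wp.fullTable {m : ℕ} {g : Fin m → Equiv.Perm (Fin n)} (hn : 0 < n) (hc : Consts L s)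
    (hg : IsGenerators g s) (hT : IsTable s.arr (fun _ => none : Table n)) :
    Wp .fullTable (fullTableTime n m) (fun s' => IsTable s'.arr (SST.fullTable L g)) s := by
  refine Wp.seq ((Wp.setOne hc).agree fun s₁ hA₁ hs₁ => ?_)
  have hc₁ := hc.agree hA₁ (by decide)
  have hg₁ := hg.agree hA₁ (by decide)
  refine Wp.seq ((Wp.sift hc₁ (hT.agree hA₁ (by decide)) hs₁).agree fun s₂ hA₂ hT₂ => ?_)
  have hc₂ := hc₁.agree hA₂ (by decide)
  have hg₂ := hg₁.agree hA₂ (by decide)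
  refine Wp.seq ((Wp.siftGenerators hn hc₂ hg₂ hT₂).agree fun s₃ hA₃ hT₃ => ?_)
  have hc₃ := hc₂.agree hA₃ (by decide)
  refine Wp.seq (((Wp.mul (by decide) (by decide) (by decide) hc₃.one).agree
    fun s₄ hA₄ hs₄ => ?_).le (by rw [hc₃.card]))
  rw [hc₃.card] at hs₄
  exact Wp.forLoop_slots (hc₃.agree hA₄ (by decide)) hs₄ (by decide) (hT₃.agree hA₄ (by decide))
    fun _ _ _ hA₅ _ hT₅ => Wp.round ((hc₃.agree hA₄ (by decide)).agree hA₅ (by decide))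
      ((hA₅.reg 15 (by decide)).trans hs₄) hT₅

/-- Reading in the order given by `u` may hit cells at any time, so the new vector is built in the
scratch array and copied back. -/
theorem Wp.permute {x : Fin n → ℕ} (hc : Consts L s) (hu : IsPermAt (s.arr 3) (s.reg 11) u)
    (hx : ∀ i : Fin n, s.arr 6 i = x i) :
    Wp .permute (n * 7 + 3 + (n * 5 + 3)) (fun s' => ∀ i : Fin n, s'.arr 6 i = x (u i)) s := by
  refine Wp.seq ((Wp.forLoop_card (B := 1 + (1 + (1 + 1))) hc (by decide)
    (Inv := fun k A => ∀ i : Fin n, (i : ℕ) < k → A 7 i = x (u i)) (by simp) ?_).agree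
    fun s₁ hA₁ hs₁ => ?_)
  · intro k s₁ hA hk hI
    have h11 : s₁.reg 11 = s.reg 11 := hA.reg 11 (by decide)
    have h3 : s₁.arr 3 = s.arr 3 := hA.arr 3 (by decide)
    have h6 : s₁.arr 6 = s.arr 6 := hA.arr 6 (by decide)
    refine Wp.seq (Wp.add (Wp.seq (Wp.load (Wp.seq (Wp.load (Wp.store fun i hi => ?_))))))
    rcases Nat.lt_succ_iff_lt_or_eq.1 hi with hi' | hi'
    · simpa [hk, Function.update_apply, hi'.ne] using hI i hi'
    · obtain rfl := Fin.ext hi'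
      simp [hk, h11, h3, h6, hu i, hx]
  · refine (Wp.forLoop_card (B := 1 + 1) (hc.agree hA₁ (by decide)) (by decide)
      (Inv := fun k A => ∀ i : Fin n, (i : ℕ) < k → A 6 i = x (u i)) (by simp) ?_).mono le_rfl
      fun s' h i => h i i.2
    intro k s₂ hA hk hI
    have h7 : s₂.arr 7 = s₁.arr 7 := hA.arr 7 (by decide)
    refine Wp.seq (Wp.load (Wp.store fun i hi => ?_))
    rcases Nat.lt_succ_iff_lt_or_eq.1 hi with hi' | hi'
    · simpa [hk, Function.update_apply, hi'.ne] using hI i hi'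
    · obtain rfl := Fin.ext hi'
      simp [hk, h7, hs₁ i i.2]

/-- The step count of `raiseStep`. -/
def raiseStepTime (n : ℕ) : ℕ :=
  n * 4 + 6 + ((1 + (1 + (1 + (1 + ((n * n * 4 + 4 + (n * 7 + 3 + (n * 5 + 3))) + 1 + 1))))) +
    1 + 1)

theorem Wp.raiseStep {x : Fin n → ℕ} (hc : Consts L s) {k j : Fin n} (hk : s.reg 8 = k)
    (hj : s.reg 9 = j) (hT : IsTable s.arr T) (hx : ∀ i : Fin n, s.arr 6 i = x i) :
    Wp .raiseStep (raiseStepTime n)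
      (fun s' => ∀ i : Fin n, s'.arr 6 i = SST.raiseStep L T k j x i) s := by
  refine Wp.seq ((Wp.findSlot hc hk hj).agree fun s₁ hA₁ hs₁ => ?_)
  have hc₁ := hc.agree hA₁ (by decide)
  have hT₁ := hT.agree hA₁ (by decide)
  have hx₁ : ∀ i : Fin n, s₁.arr 6 i = x i := by rw [hA₁.arr 6 (by decide)]; exact hx
  have h8 : s₁.reg 8 = k := (hA₁.reg 8 (by decide)).trans hk
  have h9 : s₁.reg 9 = j := (hA₁.reg 9 (by decide)).trans hj
  have hlt := slot_lt k j
  refine Wp.cond (fun hne => ?_) fun h0 => Wp.const ?_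
  · rw [hs₁.2] at hne
    cases hTe : T (slot k j) with
    | none => exact absurd (hT.unused _ hTe) hne
    | some u =>
      refine Wp.seq (Wp.load (Wp.seq (Wp.load (Wp.seq (Wp.load (Wp.seq (Wp.sub (Wp.cond
        (fun hpos => ?_) fun hzero => Wp.const ?_))))))))
      · simp [h8, h9, hc₁.leader, hx₁, Nat.sub_eq_zero_iff_le] at hpos
        simp only [SST.raiseStep, hTe, if_pos hpos]
        refine Wp.seq (((Wp.mul (by decide) (by decide) (by decide) (by simp [hc₁.one])).agree
          fun s₂ hA₂ hs₂ => ?_).le (by simp [hs₁.1]; omega))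
        simp [hs₁.1, hc₁.card] at hs₂
        refine Wp.permute (L := L) (Consts.agree ?_ hA₂ (by decide)) ?_ ?_
        · exact ⟨by simp [hc₁.card], by simp [hc₁.one], hc₁.leader⟩
        · rw [hs₂, hA₂.arr 3 (by decide)]
          exact hT₁.perm _ _ hTe
        · rw [hA₂.arr 6 (by decide)]
          exact hx₁
      · simp [h8, h9, hc₁.leader, hx₁, Nat.sub_eq_zero_iff_le] at hzero
        simp only [SST.raiseStep, hTe, if_neg hzero.not_gt]
        exact hx₁
  · rw [hs₁.2] at h0
    cases hTe : T (slot k j) with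
    | some u => rw [hT.used _ _ hTe] at h0; cases h0
    | none =>
      simp only [SST.raiseStep, hTe]
      exact hx₁

/-- The step count of `raise`. -/
def raiseTime (n : ℕ) : ℕ := n * (n * (raiseStepTime n + 3) + 3 + 3) + 3

theorem Wp.raise {x : Fin n → ℕ} (hc : Consts L s) (hT : IsTable s.arr T)
    (hx : ∀ i : Fin n, s.arr 6 i = x i) :
    Wp .raise (raiseTime n) (fun s' => ∀ i : Fin n, s'.arr 6 i = SST.raise L T x i) s := by
  refine Wp.forLoop_card hc (by decide) (Inv := fun k A => ∀ i : Fin n,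
    A 6 i = iter (fun k => iter (fun j => SST.raiseStep L T k j) n) k x i) hx
    fun k s₁ hA₁ hk hx₁ => ?_
  have hc₁ := hc.agree hA₁ (by decide)
  rw [iter_succ k.2]
  refine Wp.forLoop_card hc₁ (by decide) (Inv := fun j A => ∀ i : Fin n,
    A 6 i = iter (fun j => SST.raiseStep L T k j) j _ i) hx₁ fun j s₂ hA₂ hj hx₂ => ?_
  rw [iter_succ j.2]
  exact Wp.raiseStep (hc₁.agree hA₂ (by decide)) ((hA₂.reg 8 (by decide)).trans hk) hj
    ((hT.agree hA₁ (by decide)).agree hA₂ (by decide)) hx₂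

theorem Wp.copySolution {out : ℕ} {x : Fin n → ℕ} (hout : out ≠ 6) (hc : Consts L s)
    (hx : ∀ i : Fin n, s.arr out i = x i) :
    Wp (.copySolution out) (n * 5 + 3) (fun s' => ∀ i : Fin n, s'.arr 6 i = x i) s := by
  refine (Wp.forLoop_card (B := 1 + 1) hc (by simp [Prog.forLoop, Prog.wregs])
    (Inv := fun k A => ∀ i : Fin n, (i : ℕ) < k → A 6 i = x i) (by simp) ?_).mono le_rfl
    fun s' h i => h i i.2
  intro k s₁ hA hk hI
  have h : s₁.arr out = s.arr out := hA.arr out (by simpa [Prog.forLoop, Prog.warrs] using hout)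
  refine Wp.seq (Wp.load (Wp.store fun i hi => ?_))
  rcases Nat.lt_succ_iff_lt_or_eq.1 hi with hi' | hi'
  · simpa [hk, Function.update_apply, hi'.ne] using hI i hi'
  · obtain rfl := Fin.ext hi'
    simp [hk, h, hx]

/-- The step count of `moveSolution`. -/
def moveSolutionTime (n m : ℕ) : ℕ := 1 + (n * 5 + 3 + (fullTableTime n m + raiseTime n))

theorem Wp.moveSolution {m out : ℕ} {g : Fin m → Equiv.Perm (Fin n)} {x : Fin n → ℕ}
    (hout : out ≠ 6) (hn : 0 < n) (hcard : s.reg 1 = n) (hL : ∀ k : Fin n, s.arr 1 k = L k)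
    (hg : IsGenerators g s) (h5 : s.arr 5 = 0) (hx : ∀ i : Fin n, s.arr out i = x i) :
    Wp (.moveSolution out) (moveSolutionTime n m)
      (fun s' => ∀ i : Fin n, s'.arr 6 i = SST.raise L (SST.fullTable L g) x i) s := by
  refine Wp.seq (Wp.const ?_)
  have hc : Consts L (s.setReg 2 1) := ⟨by simp [hcard], by simp, hL⟩
  have hg' : IsGenerators g (s.setReg 2 1) := ⟨by simp [hg.length], hg.perm⟩
  refine Wp.seq ((Wp.copySolution hout hc hx).agree fun s₁ hA₁ hx₁ => ?_)
  have hA₁' : Agree (.copySolution 0) (s.setReg 2 1) s₁ := ⟨hA₁.reg, hA₁.arr⟩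
  have hc₁ := hc.agree hA₁' (by decide)
  -- Cleared marks alone represent the empty table.
  have hT₁ : IsTable s₁.arr (fun _ => none : Table n) :=
    ⟨by rw [hA₁'.arr 5 (by decide)]; simp [h5], by simp, by simp, by simp⟩
  refine Wp.seq ((Wp.fullTable hn hc₁ (hg'.agree hA₁' (by decide)) hT₁).agree
    fun s₂ hA₂ hT₂ => ?_)
  refine Wp.raise (hc₁.agree hA₂ (by decide)) hT₂ ?_
  rw [hA₂.arr 6 (by decide)]
  exact hx₁


/-! ### Polynomial time bounds -/

/-- `f n m` is bounded by a polynomial in `n + m`. -/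
def PolyBounded (f : ℕ → ℕ → ℕ) : Prop := ∃ p : Polynomial ℕ, ∀ n m, f n m ≤ p.eval (n + m)

theorem PolyBounded.const (c : ℕ) : PolyBounded fun _ _ => c :=
  ⟨.C c, fun _ _ => by simp⟩

theorem PolyBounded.left : PolyBounded fun n _ => n :=
  ⟨.X, fun _ _ => by simp⟩

theorem PolyBounded.right : PolyBounded fun _ m => m :=
  ⟨.X, fun _ _ => by simp⟩

theorem PolyBounded.add {f g : ℕ → ℕ → ℕ} (hf : PolyBounded f) (hg : PolyBounded g) :
    PolyBounded fun n m => f n m + g n m := by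
  obtain ⟨p, hp⟩ := hf
  obtain ⟨q, hq⟩ := hg
  exact ⟨p + q, fun n m => by simpa using add_le_add (hp n m) (hq n m)⟩

theorem PolyBounded.mul {f g : ℕ → ℕ → ℕ} (hf : PolyBounded f) (hg : PolyBounded g) :
    PolyBounded fun n m => f n m * g n m := by
  obtain ⟨p, hp⟩ := hf
  obtain ⟨q, hq⟩ := hg
  exact ⟨p * q, fun n m => by simpa using Nat.mul_le_mul (hp n m) (hq n m)⟩

theorem polyBounded_moveSolutionTime : PolyBounded moveSolutionTime := by
  unfold moveSolutionTime fullTableTime raiseTime raiseStepTime roundTime siftPairTime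
    siftGeneratorsTime siftTime siftStepTime
  repeat' first
    | exact .const _
    | exact .left
    | exact .right
    | apply PolyBounded.add
    | apply PolyBounded.mul

/-! ### Solving the program with SST cuts -/

theorem Algorithm.init_reg {k : ℕ} (M : Algorithm k) (w : Fin k → List ℕ) (j : Fin k) :
    (M.init w).reg (M.param j) = (w j).length := by
  dsimp only [init]
  rw [M.param_injective.extend_apply]

theorem Algorithm.init_arr {k : ℕ} (M : Algorithm k) (w : Fin k → List ℕ) (j : Fin k) :
    (M.init w).arr (M.param j) = fun i => (w j).getD i 0 := by
  dsimp only [init]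
  rw [M.param_injective.extend_apply]

theorem Algorithm.init_reg_of_ne {k : ℕ} (M : Algorithm k) (w : Fin k → List ℕ) {x : ℕ}
    (hx : ∀ j, M.param j ≠ x) : (M.init w).reg x = 0 := by
  dsimp only [init]
  rw [Function.extend_apply' _ _ _ fun ⟨j, hj⟩ => hx j hj]

theorem Algorithm.init_arr_of_ne {k : ℕ} (M : Algorithm k) (w : Fin k → List ℕ) {x : ℕ}
    (hx : ∀ j, M.param j ≠ x) : (M.init w).arr x = fun _ => 0 := by
  dsimp only [init]
  rw [Function.extend_apply' _ _ _ fun ⟨j, hj⟩ => hx j hj]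

/-- Run `M` and move the solution that it finds, if any, into the cone of the SST cuts. -/
def Algorithm.withCuts (M : Algorithm 1) : Algorithm 3 where
  -- The offset 30 lies above all names used for moving the solution. The test of register `1` sets
  -- aside `n = 0`, where the loop over the generators would have stride 0; the assignments to
  -- register `2` are idle.
  code := .seq (M.code.shift 30) (.cond (M.flag + 30)
    (.cond 1 (.moveSolution (M.out + 30)) (.const 2 0)) (.const 2 0))
  param := ![M.param 0 + 30, 0, 1]
  param_injective := by
    intro i j
    fin_cases i <;> fin_cases j <;> simp
  flag := M.flag + 30
  out := 6

theorem Algorithm.embeds_init_withCuts (M : Algorithm 1) (w v₁ v₂ : List ℕ) :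
    Embeds 30 (M.init ![w]) (M.withCuts.init ![w, v₁, v₂]) := by
  have hne : ∀ x, x ≠ M.param 0 → ∀ j, M.withCuts.param j ≠ x + 30 := by
    intro x hx j
    fin_cases j <;> simp [withCuts, hx.symm]
  have hne' : ∀ x, x ≠ M.param 0 → ∀ j, M.param j ≠ x := by
    intro x hx j
    rw [Subsingleton.elim j 0]
    exact hx.symm
  constructor <;> intro x <;> by_cases hx : x = M.param 0
  · subst hx
    exact (M.withCuts.init_reg ![w, v₁, v₂] 0).trans (M.init_reg ![w] 0).symm
  · rw [init_reg_of_ne _ _ (hne x hx), init_reg_of_ne _ _ (hne' x hx)]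
  · subst hx
    exact (M.withCuts.init_arr ![w, v₁, v₂] 0).trans (M.init_arr ![w] 0).symm
  · rw [init_arr_of_ne _ _ (hne x hx), init_arr_of_ne _ _ (hne' x hx)]

variable {m : ℕ}

theorem permWord_eq_ofFn (g : Fin m → Equiv.Perm (Fin n)) :
    permWord g = List.ofFn fun i : Fin (m * n) =>
      (g (finProdFinEquiv.symm i).1 (finProdFinEquiv.symm i).2 : ℕ) := by
  have h : ∀ (k : Fin m) (i : Fin n) (hlt : (k : ℕ) * n + i < m * n),
      (⟨k * n + i, hlt⟩ : Fin (m * n)) = finProdFinEquiv (k, i) := fun k i hlt =>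
    Fin.ext (by rw [finProdFinEquiv_apply_val]; ring)
  rw [List.ofFn_mul]
  simp only [h, Equiv.symm_apply_apply]
  rfl

theorem permWord_length (g : Fin m → Equiv.Perm (Fin n)) : (permWord g).length = m * n := by
  simp [permWord_eq_ofFn]

theorem permWord_getD (g : Fin m → Equiv.Perm (Fin n)) (q : Fin m) (i : Fin n) :
    (permWord g).getD (q * n + i) 0 = g q i := by
  have h : (q : ℕ) * n + i = (finProdFinEquiv (q, i) : Fin (m * n)) := by
    rw [finProdFinEquiv_apply_val]; ring
  rw [permWord_eq_ofFn, h, List.getD_eq_getElem _ _ (by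
    rw [List.length_ofFn]; exact (finProdFinEquiv (q, i)).2), List.getElem_ofFn, Fin.eta,
    Equiv.symm_apply_apply]

/-! ### Runs of the combined algorithm -/

section withCuts

variable {M : Algorithm 1} {enc : List ℕ} {t : ℕ}
  {g : Fin m → Equiv.Perm (Fin n)}

theorem Algorithm.Returns.withCuts_none (h : M.Returns (n := n) ![enc] t none) (v₁ v₂ : List ℕ) :
    M.withCuts.Returns (n := n) ![enc, v₁, v₂] (t + 2) none := by
  obtain ⟨s, he, hs⟩ := h
  obtain ⟨s', he', hemb⟩ := he.shift _ (M.embeds_init_withCuts enc v₁ v₂)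
  have hflag : s.reg M.flag = 0 := by
    by_contra hne
    simp [answer, hne] at hs
  have hflag' : s'.reg (M.flag + 30) = 0 := (hemb.reg _).trans hflag
  refine ⟨_, he'.seq (.condFalse hflag' (.const _ _ _)), ?_⟩
  simp [answer, withCuts, hflag']

theorem Algorithm.Returns.withCuts_some {x : Fin n → ℝ} (h : M.Returns ![enc] t (some x))
    (hx : ∀ i, x i = 0 ∨ x i = 1) (hg : Subgroup.closure (Set.range g) = Γ)
    (hL : Function.Bijective L) :
    ∃ γ ∈ Γ, ∃ t' ≤ t + (moveSolutionTime n m + 3),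
      M.withCuts.Returns ![enc, permWord g, leaderWord L] t' (some (permAct γ x)) ∧
        permAct γ x ∈ cutCone (sstCuts Γ L) := by
  obtain ⟨s, he, hs⟩ := h
  obtain ⟨s', he', hemb⟩ := he.shift _ (M.embeds_init_withCuts enc (permWord g) (leaderWord L))
  have hflag : s.reg M.flag ≠ 0 := by
    intro h0
    simp [answer, h0] at hs
  have hflag' : s'.reg (M.flag + 30) ≠ 0 := by rwa [hemb.reg]
  have hxs : x = fun i : Fin n => (s.arr M.out i : ℝ) := by simpa [answer, hflag] using hs
  set y : Fin n → ℕ := fun i => s.arr M.out i with hy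
  have hxy : ∀ i, x i = y i := fun i => congrFun hxs i
  have hy1 : ∀ i, y i ≤ 1 := by
    intro i
    have := hx i
    rw [hxy] at this
    norm_cast at this
    omega
  have hreg : ∀ r < 30, s'.reg r =
      (M.withCuts.init ![enc, permWord g, leaderWord L]).reg r := fun r hr =>
    he'.agree.reg r fun h' => absurd (Prog.le_of_mem_wregs_shift h') (by omega)
  have harr : ∀ a < 30, s'.arr a =
      (M.withCuts.init ![enc, permWord g, leaderWord L]).arr a := fun a ha =>
    he'.agree.arr a fun h' => absurd (Prog.le_of_mem_warrs_shift h') (by omega)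
  have hr0 : s'.reg 0 = m * n := by
    rw [hreg 0 (by decide), ← permWord_length g]
    exact init_reg M.withCuts _ 1
  have hr1 : s'.reg 1 = n := by
    rw [hreg 1 (by decide)]
    exact (init_reg M.withCuts _ 2).trans (by simp [leaderWord])
  have ha0 : s'.arr 0 = fun i => (permWord g).getD i 0 := by
    rw [harr 0 (by decide)]
    exact init_arr M.withCuts _ 1
  have ha1 : ∀ k : Fin n, s'.arr 1 k = L k := by
    intro k
    rw [harr 1 (by decide)]
    exact (congrFun (init_arr M.withCuts _ 2) k).trans (by simp [leaderWord])
  have ha5 : s'.arr 5 = 0 := by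
    rw [harr 5 (by decide)]
    refine init_arr_of_ne _ _ fun j => ?_
    fin_cases j <;> simp [withCuts]
  rcases Nat.eq_zero_or_pos n with rfl | hn
  · refine ⟨1, Γ.one_mem, t + (1 + 1 + 1), by omega, ⟨_, he'.seq (.condTrue hflag'
      (.condFalse hr1 (.const _ _ _))), ?_⟩, ?_⟩
    · have : (s'.setReg 2 0).reg (M.flag + 30) ≠ 0 := by simpa using hflag'
      rw [answer, if_neg (by exact this)]
      exact congrArg some (Subsingleton.elim _ _)
    · exact fun q _ => q.1.elim0
  obtain ⟨t₁, ht₁, s₁, he₁, hs₁⟩ := Wp.moveSolution (L := L) (g := g) (x := y) (out := M.out + 30)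
    (by omega) hn hr1 ha1
    ⟨hr0, fun q i => by rw [ha0]; exact permWord_getD g q i⟩ ha5
    (fun i => by rw [hemb.arr])
  have hgΓ : ∀ q, g q ∈ Γ := fun q => hg ▸ Subgroup.subset_closure ⟨q, rfl⟩
  obtain ⟨⟨γ, hγ, hraise⟩, hcut⟩ := raise_spec (valid_fullTable (L := L) hgΓ)
    (fun k j => exists_of_mem_leaderOrbit hL.surjective hg) y hy1
  -- Raising yields `x ∘ γ`, whereas the action composes with the inverse; the group element sought
  -- is therefore `γ⁻¹`.
  have hact : permAct γ⁻¹ x = fun i => ((raise L (fullTable L g) y i : ℕ) : ℝ) := by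
    funext i
    simp [permAct, hxy, hraise]
  have hflag₁ : s₁.reg (M.flag + 30) ≠ 0 := by
    rw [he₁.agree.reg]
    · exact hflag'
    · intro hmem
      have hlt : ∀ r ∈ (Prog.moveSolution 0).wregs, r < 30 := by decide +kernel
      exact absurd (hlt _ hmem) (by omega)
  refine ⟨γ⁻¹, Γ.inv_mem hγ, t + (t₁ + 1 + 1), by omega, ⟨s₁, he'.seq (.condTrue hflag'
      (.condTrue (by omega) he₁)), ?_⟩, ?_⟩
  · rw [answer, if_neg (by exact hflag₁), hact]
    congr 1
    funext i
    exact congrArg Nat.cast (hs₁ i).symm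
  · rintro ⟨l, f⟩ ⟨k, hk, hf, -⟩
    dsimp only at hk hf
    subst hk
    have := hcut k f hf
    rw [hact, neg_add_nonpos_iff]
    exact Nat.cast_le.2 this

end withCuts

end SST

theorem theorem1 :
    ∃ p : Polynomial ℕ,
      ∀ (ι : Type*) (n : ι → ℕ) (P : ∀ i, SST.BinaryProgram (n i)) (enc : ι → List ℕ)
        (T : ι → ℕ) (M : SST.Algorithm 1),
        (∀ i, M.SolvesWithin ![enc i] (P i).feasible (P i).c (T i)) →
        ∃ M' : SST.Algorithm 3,
          ∀ (i : ι) (m : ℕ) (g : Fin m → Equiv.Perm (Fin (n i)))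
            (Γ : Subgroup (Equiv.Perm (Fin (n i)))) (L : Fin (n i) → Fin (n i)),
            Subgroup.closure (Set.range g) = Γ →
            SST.IsSymmetryGroup (P i) Γ →
            Function.Bijective L →
            M'.SolvesWithin ![enc i, SST.permWord g, SST.leaderWord L]
                ((P i).feasible ∩ SST.cutCone (SST.sstCuts Γ L)) (P i).c
                (T i + p.eval (n i + m)) ∧
              ∀ (t : ℕ) (x : Fin (n i) → ℝ), M.Returns ![enc i] t (some x) →
                ∃ γ ∈ Γ, ∃ t' ≤ t + p.eval (n i + m),
                  M'.Returns ![enc i, SST.permWord g, SST.leaderWord L] t'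
                      (some (SST.permAct γ x)) ∧
                    SST.permAct γ x ∈ SST.cutCone (SST.sstCuts Γ L) := by
  -- The extra 3 pays for the tests of the flag and of `n`, and for the assignment in an idle
  -- branch.
  obtain ⟨p, hp⟩ := SST.polyBounded_moveSolutionTime.add (.const 3)
  refine ⟨p, fun ι n P enc T M hM => ⟨M.withCuts, fun i m g Γ L hg hΓ hL => ?_⟩⟩
  obtain ⟨t, ht, r, hr, ha⟩ := hM i
  have hpi : SST.moveSolutionTime (n i) m + 3 ≤ p.eval (n i + m) := hp (n i) m
  have hmove : ∀ (t' : ℕ) (x : Fin (n i) → ℝ), M.Returns ![enc i] t' (some x) →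
      t' = t ∧ some x = r ∧ ∃ γ ∈ Γ, ∃ t' ≤ t + p.eval (n i + m),
        M.withCuts.Returns ![enc i, SST.permWord g, SST.leaderWord L] t'
            (some (SST.permAct γ x)) ∧
          SST.permAct γ x ∈ SST.cutCone (SST.sstCuts Γ L) := by
    intro t' x hx
    obtain ⟨s₁, he₁, hs₁⟩ := hr
    obtain ⟨s₂, he₂, hs₂⟩ := id hx
    -- By determinism any run that returns `x` is the run known to solve the program, so `x` is
    -- optimal and in particular binary.
    obtain ⟨rfl, rfl⟩ := he₁.deterministic he₂
    rw [← hs₂] at hs₁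
    subst hs₁
    obtain ⟨γ, hγ, t'', ht'', h⟩ := hx.withCuts_some ha.1.1 hg hL
    exact ⟨rfl, rfl, γ, hγ, t'', by omega, h⟩
  refine ⟨?_, fun t' x hx => ?_⟩
  · rcases r with _ | x
    · refine ⟨t + 2, by omega, none, hr.withCuts_none _ _, ?_⟩
      have ha' : (P i).feasible = ∅ := ha
      simp [SST.IsAnswer, ha']
    · obtain ⟨-, -, γ, hγ, t', ht', hret, hcut⟩ := hmove t x hr
      obtain ⟨hfeas, hobj⟩ := hΓ γ hγ x ha.1
      refine ⟨t', by omega, _, hret, ⟨hfeas, hcut⟩, fun y hy => ?_⟩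
      -- The cuts only shrink the feasible set, and the moved solution keeps the optimal value of
      -- the larger set.
      rw [hobj]
      exact ha.2 y hy.1
  · obtain ⟨rfl, -, h⟩ := hmove t' x hx
    exact h
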